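/- Let $X_0,X_1,\dots,X_n$ be $C^\infty$ vector fields on an open set $\Omega\subset\mathbb{R}^p$. Assign the weights $p_0=2$ and $p_i=1$ for $i=1,\dots,n$, and to a (nonempty) multiindex $I=(i_1,\dots,i_k)$ with entries in $\{0,\dots,n\}$ the weight $|I|=\sum_{j=1}^k p_{i_j}$. Put $X_{[I]}=[X_{i_1},[X_{i_2},\dots[X_{i_{k-1}},X_{i_k}]\dots]]$, with $X_{[(i)]}=X_i$, and let $A_{IJ}$ be the universal constants with $X_{[I]}=\sum_J A_{IJ}X_{j_1}\cdots X_{j_m}$, i.e. $A_{IJ}$ is the coefficient of the word $\xi_{j_1}\cdots\xi_{j_m}$, $J=(j_1,\dots,j_m)$, in the iterated commutator $[\xi_{i_1},[\xi_{i_2},\dots[\xi_{i_{k-1}},\xi_{i_k}]\dots]]$ of noncommuting variables $\xi_0,\dots,\xi_n$. Let $r$ be a nonnegative integer and suppose that $X_0,\dots,X_n$ are free up to weight $r$ at every point $x\in\Omega$: for all real constants $(a_I)_{|I|\le r}$, $$\sum_{|I|\le r}a_I\,(X_{[I]})_x=0\quad\Longrightarrow\quad\sum_{|I|\le r}a_IA_{IJ}=0\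 \text{ for all }J.$$ Let $B$ be a set of multiindices $I$ with $|I|\le r$ such that $\{(X_{[I]})_x\}_{I\in B}$ is a basis of $\mathbb{R}^p$ for every $x\in\Omega$, and let $\overline{x}\in\Omega$. For a vector field $V$ on $\Omega$ let $\exp(V)(\overline{x})=\varphi(1)$, where $\varphi:[0,1]\to\Omega$ solves $\varphi'=V_{\varphi}$, $\varphi(0)=\overline{x}$. Then the canonical coordinate map $$\Phi(u)=\exp\Big(\sum_{I\in B}u_IX_{[I]}\Big)(\overline{x}),\qquad u=(u_I)_{I\in B}\in\mathbb{R}^B,$$ is defined and $C^\infty$ with invertible differential for all $u$ in a neighbourhood of $0$, and for every multiindex $I$ the vector field $X_{[I]}$, written in the coordinates $u$, has weight $\ge-|I|$. Here a function $f$ of $u$ which is $C^\infty$ near $0$ has weight $\ge s$ if its Taylor expansion at $0$ contains no term $a\,u_{I_1}\cdots u_{I_k}$ ($I_1,\dots,I_k\in B$) with $a\ne0$ and $|I_1|+\dots+|I_k|<s$; and a vector field $\sum_{J\in B}f_J(u)\,\partial/\partial u_J$ with coefficients $C^\infty$ near $0$ has weight $\ge s$ if $f_J$ has weight $\ge s+|J|$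 for every $J\in B$. -/

import Mathlib

open scoped ContDiff Topology

noncomputable section

namespace WeightedFields

/-- A multiindex `(i₁, …, i_k)` with entries in `{0, 1, …, n}`. The multiindices that matter are
the nonempty ones; this is required explicitly wherever it plays a role. -/
abbrev MultiIndex (n : ℕ) : Type := List (Fin (n + 1))

/-- The weight of an index: `p₀ = 2` and `p_i = 1` for `i = 1, …, n`. -/
def indexWeight {n : ℕ} (i : Fin (n + 1)) : ℕ := if i = 0 then 2 else 1

/-- The weight `|I| = p_{i₁} + ⋯ + p_{i_k}` of a multiindex. -/
def weight {n : ℕ} (I : MultiIndex n) : ℕ := (I.map indexWeight).sum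

/-- The iterated commutator `X_[I] = [X_{i₁}, [X_{i₂}, … [X_{i_{k-1}}, X_{i_k}] … ]]` of vector
fields (the value at the empty multiindex is a convention and is never used). -/
def iterBracket {n : ℕ} {E : Type*} [NormedAddCommGroup E] [NormedSpace ℝ E]
    (X : Fin (n + 1) → E → E) : MultiIndex n → E → E
  | [] => 0
  | [i] => X i
  | i :: j :: I => VectorField.lieBracket ℝ (X i) (iterBracket X (j :: I))

/-- The noncommutative polynomial `ξ_[I] = ad ξ_{i₁} ⋯ ad ξ_{i_{k-1}} ξ_{i_k}` in the free
associative algebra on `ξ₀, …, ξ_n`, where `ad a b = a b - b a`. -/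
def formalCommutator {n : ℕ} : MultiIndex n → MonoidAlgebra ℝ (FreeMonoid (Fin (n + 1)))
  | [] => 0
  | [i] => MonoidAlgebra.of ℝ _ (FreeMonoid.of i)
  | i :: j :: I =>
      MonoidAlgebra.of ℝ _ (FreeMonoid.of i) * formalCommutator (j :: I) -
        formalCommutator (j :: I) * MonoidAlgebra.of ℝ _ (FreeMonoid.of i)

/-- The universal constants `A_{IJ}` with `X_[I] = ∑_J A_{IJ} X_J`: the coefficient of the word
`ξ_J = ξ_{j₁} ⋯ ξ_{j_m}` in `ξ_[I]`. -/
def commCoeff {n : ℕ} (I J : MultiIndex n) : ℝ :=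
  (formalCommutator I).coeff (FreeMonoid.ofList J)

/-- `X₀, …, X_n` are free up to weight `s` at `x`: for every family of constants
`(a_I)_{|I| ≤ s}`, the relation `∑ a_I X_[I](x) = 0` implies `∑ a_I A_{IJ} = 0` for all `J`. -/
def IsFreeUpToWeight {n : ℕ} {E : Type*} [NormedAddCommGroup E] [NormedSpace ℝ E]
    (X : Fin (n + 1) → E → E) (s : ℕ) (x : E) : Prop :=
  ∀ a : MultiIndex n →₀ ℝ, (∀ I ∈ a.support, I ≠ [] ∧ weight I ≤ s) →
    (a.sum fun I c => c • iterBracket X I x) = 0 →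
      ∀ J : MultiIndex n, (a.sum fun I c => c * commCoeff I J) = 0

/-- `y = exp(V)(x)` for a vector field `V` on `Ω`: the solution of `φ' = V(φ)`, `φ(0) = x`,
exists in `Ω` up to time `1`, and `φ(1) = y`. -/
def IsExp {E : Type*} [NormedAddCommGroup E] [NormedSpace ℝ E]
    (Ω : Set E) (V : E → E) (x y : E) : Prop :=
  ∃ φ : ℝ → E, φ 0 = x ∧ φ 1 = y ∧
    ∀ t ∈ Set.Icc (0 : ℝ) 1, φ t ∈ Ω ∧ HasDerivWithinAt φ (V (φ t)) (Set.Icc 0 1) t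

open Classical in
/-- The exponential `exp(V)(x)` of a vector field `V` on `Ω` (with the value `x` if the solution
does not exist up to time `1`). -/
def expField {E : Type*} [NormedAddCommGroup E] [NormedSpace ℝ E]
    (Ω : Set E) (V : E → E) (x : E) : E :=
  if h : ∃ y, IsExp Ω V x y then h.choose else x

/-- The vector field `∑_{I ∈ B} u_I X_[I]`. -/
def combination {n : ℕ} {E : Type*} [NormedAddCommGroup E] [NormedSpace ℝ E]
    (X : Fin (n + 1) → E → E) (B : Finset (MultiIndex n)) (u : B → ℝ) : E → E :=
  fun y => ∑ I : B, u I • iterBracket X I y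

/-- Canonical coordinates at `x`: the map `u ↦ exp(∑_{I ∈ B} u_I X_[I])(x)`. -/
def canonicalMap {n : ℕ} {E : Type*} [NormedAddCommGroup E] [NormedSpace ℝ E]
    (Ω : Set E) (X : Fin (n + 1) → E → E) (B : Finset (MultiIndex n)) (x : E) (u : B → ℝ) : E :=
  expField Ω (combination X B u) x

/-- A function of the coordinates `(u_I)_{I ∈ B}`, with `u_I` of weight `|I|`, has weight `≥ s`:
it is `C^∞` near the origin and its Taylor expansion at the origin contains no nonzero term
`a u_{I₁} ⋯ u_{I_k}` with `|I₁| + ⋯ + |I_k| < s`; that is, the partial derivative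
`∂^k f / ∂u_{I₁} ⋯ ∂u_{I_k}` vanishes at `0` for all such `I₁, …, I_k`. -/
def FunHasWeightGE {n : ℕ} {B : Finset (MultiIndex n)} (s : ℤ) (f : (B → ℝ) → ℝ) : Prop :=
  (∀ᶠ u in 𝓝 (0 : B → ℝ), ContDiffAt ℝ ∞ f u) ∧
    ∀ (k : ℕ) (J : Fin k → B), (∑ i, (weight (J i).1 : ℤ)) < s →
      iteratedFDeriv ℝ k f 0 (fun i => Pi.single (J i) (1 : ℝ)) = 0

/-- A vector field `∑_{I ∈ B} f_I ∂/∂u_I`, with `∂/∂u_I` of weight `-|I|`, has weight `≥ s`: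
each `f_I` has weight `≥ s + |I|`. -/
def FieldHasWeightGE {n : ℕ} {B : Finset (MultiIndex n)} (s : ℤ) (Y : (B → ℝ) → (B → ℝ)) : Prop :=
  ∀ I : B, FunHasWeightGE (s + (weight I.1 : ℤ)) (fun u => Y u I)

end WeightedFields

end

open WeightedFields

/-! Let `Y J` be the pullback of X_[J], J ∈ B, under Φ. Since t ↦ Φ(tu) is the integral curve of ∑
u_I X_[I], the derivative of Φ at u sends u to ∑ u_I X_[I](Φ(u)); in the coordinates u this says
that ∑ u_I Y_I is the radial field u. Differentiating this identity in the direction Y_J gives the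
structure equation R Y_J = Y_J − ∑ Y_J^I Y_I + ∑ u_I [Y_I, Y_J], where R is the derivative along the
radial field (`fderiv_radial`).

On Taylor terms of degree m, R is multiplication by m. After subtracting the identity matrix, the
equation therefore determines the degree m coefficients of the Y_J from those of lower degree, and
induction on m gives the weights (`iterPderiv_eq_zero_of_structureEquation`), provided that [Y_I,
Y_J] is a constant combination of Y_M with |M| = |I| + |J| whenever |I| + |J| ≤ r.

That is where freeness enters (`iterBracket_eq_sum_basis`): expand a commutator in the basis at one
point; freeness lifts this relation to the free algebra, homogeneity discards the terms of other
weights, and letting words act as differential operators carries it to all of Ω. Brackets of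
commutators reduce to commutators by the Jacobi identity. Weights above r never matter, since every
component K ∈ B has |K| ≤ r.

Smoothness of Φ follows from the inverse function theorem applied to the integral equation in the
space of continuous curves (`exists_smooth_solution`). -/

section Superposition

-- Smoothness of superposition operators on spaces of continuous maps

universe u v

variable {K : Type v} [TopologicalSpace K] [CompactSpace K]
variable {E G : Type u} [NormedAddCommGroup E] [NormedSpace ℝ E]
  [NormedAddCommGroup G] [NormedSpace ℝ G]

/-- Pointwise evaluation of a continuous family of operators on a continuous family of vectors. -/
noncomputable def ContinuousMap.pointwiseApply :
    C(K, E →L[ℝ] G) →L[ℝ] C(K, E) →L[ℝ] C(K, G) :=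
  LinearMap.mkContinuous₂
    (LinearMap.mk₂ ℝ (fun (A : C(K, E →L[ℝ] G)) (h : C(K, E)) =>
        (⟨fun t => A t (h t), by fun_prop⟩ : C(K, G)))
      (fun A A' h => by ext t; simp) (fun c A h => by ext t; simp)
      (fun A h h' => by ext t; simp) (fun c A h => by ext t; simp)) 1
    (fun A h => by
      rw [one_mul]
      refine (ContinuousMap.norm_le _ (by positivity)).2 fun t => ?_
      exact (A t).le_of_opNorm_le_of_le (A.norm_coe_le_norm t) (h.norm_coe_le_norm t))

@[simp]
theorem ContinuousMap.pointwiseApply_apply (A : C(K, E →L[ℝ] G)) (h : C(K, E)) (t : K) :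
    ContinuousMap.pointwiseApply A h t = A t (h t) := rfl

/-- Postcomposition with `fderiv ℝ F` is continuous for the sup norm, so `fderiv ℝ F` is uniformly
close to its values along φ on all segments from φ(t) to φ(t) + h(t). The mean value inequality then
bounds the remainder uniformly in t. -/
theorem hasFDerivAt_superposition {F : E → G} (hF : ContDiff ℝ 1 F) (φ : C(K, E)) :
    HasFDerivAt (fun φ : C(K, E) => (⟨F, hF.continuous⟩ : C(E, G)).comp φ)
      (ContinuousMap.pointwiseApply
        ((⟨fderiv ℝ F, hF.continuous_fderiv one_ne_zero⟩ : C(E, E →L[ℝ] G)).comp φ)) φ := by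
  set D : C(E, E →L[ℝ] G) := ⟨fderiv ℝ F, hF.continuous_fderiv one_ne_zero⟩
  rw [hasFDerivAt_iff_isLittleO_nhds_zero, Asymptotics.isLittleO_iff]
  intro c hc
  have hcont : ContinuousAt (fun ψ : C(K, E) => D.comp ψ) φ :=
    (ContinuousMap.continuous_postcomp D).continuousAt
  obtain ⟨δ, hδ, hball⟩ := (Metric.continuousAt_iff (α := C(K, E))
    (β := C(K, E →L[ℝ] G))).1 hcont c hc
  filter_upwards [Metric.ball_mem_nhds (0 : C(K, E)) hδ] with h hh
  refine (ContinuousMap.norm_le _ (by positivity)).2 fun t => ?_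
  have key : ∀ y ∈ segment ℝ (φ t) (φ t + h t), ‖fderiv ℝ F y - D (φ t)‖ ≤ c := by
    intro y hy
    rw [segment_eq_image'] at hy
    obtain ⟨s, hs, rfl⟩ := hy
    have h1 : dist (φ + s • h) φ < δ := by
      rw [dist_eq_norm, add_sub_cancel_left, norm_smul, Real.norm_of_nonneg hs.1]
      have : ‖h‖ < δ := by simpa using hh
      nlinarith [norm_nonneg h, hs.2]
    have h2 := (ContinuousMap.dist_apply_le_dist (f := D.comp (φ + s • h)) (g := D.comp φ) t).trans
      (hball h1).le
    rw [dist_eq_norm] at h2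
    simpa [D] using h2
  have hmv := (convex_segment (φ t) (φ t + h t)).norm_image_sub_le_of_norm_fderiv_le'
    (𝕜 := ℝ) (f := F) (φ := D (φ t)) (C := c)
    (fun y _ => hF.differentiable one_ne_zero y) key
    (left_mem_segment _ _ _) (right_mem_segment _ _ _)
  rw [add_sub_cancel_left] at hmv
  refine le_trans (by simpa [D] using hmv) ?_
  gcongr
  exact h.norm_coe_le_norm t

/-- The derivative is again a superposition operator, that of `fderiv ℝ F`, followed by a continuous
linear map. The induction therefore has to allow the target to change from `G` to `E →L[ℝ] G`. -/
theorem contDiff_superposition_nat (n : ℕ) : ∀ {G : Type u} [NormedAddCommGroup G]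
    [NormedSpace ℝ G] {F : E → G} (hF : ContDiff ℝ n F),
    ContDiff ℝ n (fun φ : C(K, E) => (⟨F, hF.continuous⟩ : C(E, G)).comp φ) := by
  induction n with
  | zero =>
    intro G _ _ F hF
    exact contDiff_zero.2 (ContinuousMap.continuous_postcomp _)
  | succ n ih =>
    intro G _ _ F hF
    have h1 : ContDiff ℝ 1 F := hF.of_le (by norm_cast; omega)
    have h2 : ContDiff ℝ n (fderiv ℝ F) := hF.fderiv_right (by norm_cast)
    push_cast
    refine contDiff_succ_iff_hasFDerivAt.2 ⟨_, ?_, fun φ => hasFDerivAt_superposition h1 φ⟩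
    exact ContinuousMap.pointwiseApply.contDiff.comp (ih h2)

theorem contDiff_superposition {F : E → G} (hF : ContDiff ℝ ∞ F) :
    ContDiff ℝ ∞ (fun φ : C(K, E) => (⟨F, hF.continuous⟩ : C(E, G)).comp φ) :=
  contDiff_infty.2 fun n => contDiff_superposition_nat n (contDiff_infty.1 hF n)

end Superposition

/-! ### Smooth dependence of solutions on parameters -/

section Flow

variable {E : Type*} [NormedAddCommGroup E]

open Set MeasureTheory

/-- The extension of a curve on `[0, 1]` by constants. -/
noncomputable def extendCurve (φ : C(Icc (0 : ℝ) 1, E)) : ℝ → E :=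
  IccExtend zero_le_one φ

theorem continuous_extendCurve (φ : C(Icc (0 : ℝ) 1, E)) : Continuous (extendCurve φ) :=
  φ.continuous.Icc_extend'

theorem norm_extendCurve_le (φ : C(Icc (0 : ℝ) 1, E)) (s : ℝ) : ‖extendCurve φ s‖ ≤ ‖φ‖ :=
  φ.norm_coe_le_norm _

theorem extendCurve_of_mem (φ : C(Icc (0 : ℝ) 1, E)) {s : ℝ} (hs : s ∈ Icc (0 : ℝ) 1) :
    extendCurve φ s = φ ⟨s, hs⟩ :=
  IccExtend_of_mem _ _ hs

variable [NormedSpace ℝ E]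

/-- The operator `φ ↦ (t ↦ ∫₀ᵗ φ)` on curves on `[0, 1]`. -/
noncomputable def primitiveCLM : C(Icc (0 : ℝ) 1, E) →L[ℝ] C(Icc (0 : ℝ) 1, E) :=
  LinearMap.mkContinuous
    { toFun := fun φ => ⟨fun t => ∫ s in (0 : ℝ)..t, extendCurve φ s,
        (intervalIntegral.continuous_primitive
          (fun a b => (continuous_extendCurve φ).intervalIntegrable a b) 0).comp
            continuous_subtype_val⟩
      map_add' := fun φ ψ => by
        ext t
        exact intervalIntegral.integral_add ((continuous_extendCurve φ).intervalIntegrable _ _)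
          ((continuous_extendCurve ψ).intervalIntegrable _ _)
      map_smul' := fun c φ => by
        ext t
        exact intervalIntegral.integral_smul c (extendCurve φ) } 1
    (fun φ => by
      rw [one_mul]
      refine (ContinuousMap.norm_le _ (norm_nonneg _)).2 fun t => ?_
      refine (intervalIntegral.norm_integral_le_of_norm_le_const (C := ‖φ‖)
        fun s _ => norm_extendCurve_le φ s).trans ?_
      rw [sub_zero, abs_of_nonneg t.2.1]
      nlinarith [t.2.2, norm_nonneg φ])

theorem primitiveCLM_apply (φ : C(Icc (0 : ℝ) 1, E)) (t : Icc (0 : ℝ) 1) :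
    primitiveCLM φ t = ∫ s in (0 : ℝ)..t, extendCurve φ s := rfl

/-- Smooth dependence on `u` of the solution on `[0, 1]` of `φ' = ∑ uᵢ Zᵢ(φ)`, `φ(0) = x`, for
small `u`. -/
theorem exists_smooth_solution {ι : Type*} [Fintype ι] {E : Type*} [NormedAddCommGroup E]
    [NormedSpace ℝ E] [CompleteSpace E] (Z : ι → E → E)
    (hZ : ∀ i, ContDiff ℝ ∞ (Z i)) (x : E) :
    ∃ φ : (ι → ℝ) → C(Icc (0 : ℝ) 1, E), φ 0 = ContinuousMap.const _ x ∧
      (∀ᶠ u in 𝓝 0, ContDiffAt ℝ ∞ φ u) ∧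
      ∀ᶠ u in 𝓝 0, ∀ t : Icc (0 : ℝ) 1,
        φ u t = x + ∫ s in (0 : ℝ)..t, ∑ i, u i • Z i (extendCurve (φ u) s) := by
  classical
  let C := C(Icc (0 : ℝ) 1, E)
  let S : ι → C → C := fun i φ => (⟨Z i, (hZ i).continuous⟩ : C(E, E)).comp φ
  have hS : ∀ i, ContDiff ℝ ∞ (S i) := fun i => contDiff_superposition (hZ i)
  let c : C := ContinuousMap.const _ x
  let N : (ι → ℝ) × C → C := fun q => primitiveCLM (∑ i, q.1 i • S i q.2)
  have hN : ContDiff ℝ ∞ N := by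
    refine (primitiveCLM (E := E)).contDiff.comp (ContDiff.sum fun i _ => ContDiff.fun_smul ?_ ?_)
    · exact (contDiff_apply ℝ ℝ i).comp contDiff_fst
    · exact (hS i).comp contDiff_snd
  -- The integral equation reads T(u, φ) = (u, c), so the solution is the second component of the
  -- local inverse at (u, c). As N vanishes identically at u = 0, the derivative of T at (0, c) is
  -- (v, h) ↦ (v, h − Av), with explicit inverse.
  let T : (ι → ℝ) × C → (ι → ℝ) × C := fun q => (q.1, q.2 - N q)
  have hT : ContDiff ℝ ∞ T := contDiff_fst.prodMk (contDiff_snd.sub hN)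
  let A : (ι → ℝ) →L[ℝ] C := primitiveCLM.comp
    (∑ i, (ContinuousLinearMap.proj (R := ℝ) (φ := fun _ : ι => ℝ) i).smulRight (S i c))
  have hN' : HasFDerivAt N (A.comp (ContinuousLinearMap.fst ℝ (ι → ℝ) C)) (0, c) := by
    change HasFDerivAt (fun q => primitiveCLM (∑ i, q.1 i • S i q.2))
      ((primitiveCLM (E := E)).comp ((∑ i, (ContinuousLinearMap.proj (R := ℝ)
        (φ := fun _ : ι => ℝ) i).smulRight (S i c)).comp (ContinuousLinearMap.fst ℝ (ι → ℝ) C)))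
      (0, c)
    refine (primitiveCLM (E := E)).hasFDerivAt.comp ((0 : ι → ℝ), c) ?_
    rw [ContinuousLinearMap.finsetSum_comp]
    refine HasFDerivAt.fun_sum fun i _ => ?_
    have h1 : HasFDerivAt (fun q : (ι → ℝ) × C => q.1 i)
        ((ContinuousLinearMap.proj (R := ℝ) (φ := fun _ : ι => ℝ) i).comp
          (ContinuousLinearMap.fst ℝ (ι → ℝ) C)) (0, c) :=
      ((ContinuousLinearMap.proj (R := ℝ) (φ := fun _ : ι => ℝ) i).comp
        (ContinuousLinearMap.fst ℝ (ι → ℝ) C)).hasFDerivAt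
    have h2 : HasFDerivAt (fun q : (ι → ℝ) × C => S i q.2) _ ((0 : ι → ℝ), c) :=
      (((hS i).comp contDiff_snd).differentiable (by simp) _).hasFDerivAt
    convert! h1.smul h2 using 1
    refine ContinuousLinearMap.ext fun q => ?_
    simp
  let T' : ((ι → ℝ) × C) ≃L[ℝ] (ι → ℝ) × C :=
    ContinuousLinearEquiv.equivOfInverse
      ((ContinuousLinearMap.fst ℝ (ι → ℝ) C).prod
        (ContinuousLinearMap.snd ℝ (ι → ℝ) C - A.comp (ContinuousLinearMap.fst ℝ (ι → ℝ) C)))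
      ((ContinuousLinearMap.fst ℝ (ι → ℝ) C).prod
        (ContinuousLinearMap.snd ℝ (ι → ℝ) C + A.comp (ContinuousLinearMap.fst ℝ (ι → ℝ) C)))
      (fun q => by simp) (fun q => by simp)
  have hT' : HasFDerivAt T (T' : ((ι → ℝ) × C) →L[ℝ] (ι → ℝ) × C) (0, c) :=
    hasFDerivAt_fst.prodMk (hasFDerivAt_snd.sub hN')
  have hTc : T (0, c) = (0, c) := by simp [T, N]
  let e := (hT.contDiffAt (x := ((0 : ι → ℝ), c))).toOpenPartialHomeomorph T hT' (by simp)
  have he : ∀ q, e q = T q := fun q => rfl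
  have h0s : ((0 : ι → ℝ), c) ∈ e.source :=
    (hT.contDiffAt (x := ((0 : ι → ℝ), c))).mem_toOpenPartialHomeomorph_source hT' (by simp)
  have h0t : ((0 : ι → ℝ), c) ∈ e.target := by
    have := e.map_source h0s
    rwa [he, hTc] at this
  have hsymm0 : e.symm (0, c) = (0, c) := by
    have := e.left_inv h0s
    rwa [he, hTc] at this
  have hin : Filter.Tendsto (fun u : ι → ℝ => (u, c)) (𝓝 0) (𝓝 (0, c)) := by
    refine Continuous.tendsto' (by fun_prop) _ _ rfl
  have htgt : ∀ᶠ u in 𝓝 (0 : ι → ℝ), (u, c) ∈ e.target :=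
    hin.eventually (e.open_target.mem_nhds h0t)
  refine ⟨fun u => (e.symm (u, c)).2, ?_, ?_, ?_⟩
  · change (e.symm (0, c)).2 = c
    rw [hsymm0]
  · have hinv : ∀ᶠ q in 𝓝 ((0 : ι → ℝ), c), (fderiv ℝ T q).IsInvertible := by
      have h1 : ContinuousAt (fderiv ℝ T) ((0 : ι → ℝ), c) :=
        (hT.continuous_fderiv (by simp)).continuousAt
      have h2 := T'.nhds
      rw [← hT'.fderiv] at h2
      exact h1.eventually h2
    have hs : Filter.Tendsto (fun u : ι → ℝ => e.symm (u, c)) (𝓝 0) (𝓝 (0, c)) := by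
      have := (e.continuousAt_symm h0t).tendsto.comp hin
      rwa [hsymm0] at this
    filter_upwards [htgt, hs.eventually hinv] with u hu ⟨M, hM⟩
    have h3 : ContDiffAt ℝ ∞ e.symm (u, c) := by
      refine e.contDiffAt_symm (f₀' := M) hu ?_ hT.contDiffAt
      rw [hM]
      exact (hT.differentiable (by simp) _).hasFDerivAt
    exact contDiffAt_snd.comp u (h3.comp u (contDiffAt_id.prodMk contDiffAt_const))
  · filter_upwards [htgt] with u hu t
    have h1 : T (e.symm (u, c)) = (u, c) := e.right_inv hu
    have h2 : (e.symm (u, c)).1 = u := congrArg Prod.fst h1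
    have h3 : (e.symm (u, c)).2 - N (e.symm (u, c)) = c := congrArg Prod.snd h1
    have h4 := congrArg (fun f : C => f t) (sub_eq_iff_eq_add.1 h3)
    refine h4.trans ?_
    simp only [N, h2]
    refine congrArg (x + ·) ((primitiveCLM_apply _ _).trans ?_)
    refine intervalIntegral.integral_congr fun s _ => ?_
    simp [extendCurve, IccExtend, S]
    rfl

end Flow

/-! ### The exponential map and its behaviour along rays -/

section Exponential

variable {E : Type*} [NormedAddCommGroup E] [NormedSpace ℝ E]

open Set

/-- Integral curves in an open set of a `C¹` field are determined by their initial value. -/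
theorem integralCurve_unique {Ω : Set E} (hΩ : IsOpen Ω) {V : E → E} (hV : ContDiffOn ℝ 1 V Ω)
    {φ ψ : ℝ → E} (h0 : φ 0 = ψ 0)
    (hφ : ∀ t ∈ Icc (0 : ℝ) 1, φ t ∈ Ω ∧ HasDerivWithinAt φ (V (φ t)) (Icc 0 1) t)
    (hψ : ∀ t ∈ Icc (0 : ℝ) 1, ψ t ∈ Ω ∧ HasDerivWithinAt ψ (V (ψ t)) (Icc 0 1) t) :
    EqOn φ ψ (Icc 0 1) := by
  have cφ : ContinuousOn φ (Icc 0 1) := fun t ht => (hφ t ht).2.continuousWithinAt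
  have cψ : ContinuousOn ψ (Icc 0 1) := fun t ht => (hψ t ht).2.continuousWithinAt
  -- On this compact set the locally Lipschitz field V is Lipschitz, which is all that Grönwall
  -- uniqueness requires.
  set s : Set E := φ '' Icc 0 1 ∪ ψ '' Icc 0 1
  have hs : IsCompact s := (isCompact_Icc.image_of_continuousOn cφ).union
    (isCompact_Icc.image_of_continuousOn cψ)
  have hsΩ : s ⊆ Ω := union_subset (image_subset_iff.2 fun t ht => (hφ t ht).1)
    (image_subset_iff.2 fun t ht => (hψ t ht).1)
  have hloc : LocallyLipschitzOn s V := fun x hx => by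
    obtain ⟨K, t, ht, hK⟩ :=
      ((hV.contDiffAt (hΩ.mem_nhds (hsΩ hx)))).exists_lipschitzOnWith
    exact ⟨K, t, mem_nhdsWithin_of_mem_nhds ht, hK⟩
  obtain ⟨K, hK⟩ := hloc.exists_lipschitzOnWith_of_compact hs
  refine ODE_solution_unique_of_mem_Icc_right (v := fun _ => V) (s := fun _ => s) (K := K)
    (fun _ _ => hK) cφ (fun t ht => ?_) (fun t ht => ?_) cψ (fun t ht => ?_) (fun t ht => ?_) h0
  · exact (hφ t (Ico_subset_Icc_self ht)).2.mono_of_mem_nhdsWithin (Icc_mem_nhdsGE_of_mem ht)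
  · exact Or.inl (mem_image_of_mem _ (Ico_subset_Icc_self ht))
  · exact (hψ t (Ico_subset_Icc_self ht)).2.mono_of_mem_nhdsWithin (Icc_mem_nhdsGE_of_mem ht)
  · exact Or.inr (mem_image_of_mem _ (Ico_subset_Icc_self ht))

theorem expField_eq {Ω : Set E} (hΩ : IsOpen Ω) {V : E → E} (hV : ContDiffOn ℝ 1 V Ω) {x y : E}
    (h : IsExp Ω V x y) : expField Ω V x = y := by
  have hex : ∃ y, IsExp Ω V x y := ⟨y, h⟩
  rw [expField, dif_pos hex]
  obtain ⟨φ, h0, h1, hφ⟩ := hex.choose_spec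
  obtain ⟨ψ, g0, g1, hψ⟩ := h
  rw [← h1, ← g1]
  exact integralCurve_unique hΩ hV (h0.trans g0.symm) hφ hψ (right_mem_Icc.2 zero_le_one)

/-- Rescaling time, t ↦ φ(st), turns an integral curve of V into one of sV. Thus the exponential
along a ray traces a single integral curve. -/
theorem IsExp.smul {Ω : Set E} {V : E → E} {x : E} {φ : ℝ → E} (h0 : φ 0 = x)
    (hφ : ∀ t ∈ Icc (0 : ℝ) 1, φ t ∈ Ω ∧ HasDerivWithinAt φ (V (φ t)) (Icc 0 1) t)
    {s : ℝ} (hs : s ∈ Icc (0 : ℝ) 1) : IsExp Ω (fun y => s • V y) x (φ s) := by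
  have hmaps : MapsTo (fun t : ℝ => s * t) (Icc 0 1) (Icc 0 1) := fun t ht =>
    ⟨mul_nonneg hs.1 ht.1, mul_le_one₀ hs.2 ht.1 ht.2⟩
  refine ⟨fun t => φ (s * t), by simp [h0], by simp, fun t ht => ⟨(hφ _ (hmaps ht)).1, ?_⟩⟩
  have h1 : HasDerivWithinAt (fun t : ℝ => s * t) s (Icc 0 1) t := by
    simpa using ((hasDerivAt_id t).const_mul s).hasDerivWithinAt
  exact (hφ _ (hmaps ht)).2.scomp t h1 hmaps

/-- Existence, smoothness and first order behaviour along rays of the map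
`u ↦ exp(∑ uᵢ Wᵢ)(x)` near the origin. -/
theorem eventually_expField_sum [FiniteDimensional ℝ E] {ι : Type*} [Fintype ι] {Ω : Set E}
    (hΩ : IsOpen Ω) {W : ι → E → E} (hW : ∀ i, ContDiffOn ℝ ∞ (W i) Ω) {x : E} (hx : x ∈ Ω)
    {Φ : (ι → ℝ) → E} (hΦ : ∀ u, Φ u = expField Ω (fun y => ∑ i, u i • W i y) x) :
    (∀ᶠ u in 𝓝 0, IsExp Ω (fun y => ∑ i, u i • W i y) x (Φ u) ∧ ContDiffAt ℝ ∞ Φ u ∧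
      fderiv ℝ Φ u u = ∑ i, u i • W i (Φ u)) ∧
    Φ 0 = x ∧ ∀ v, fderiv ℝ Φ 0 v = ∑ i, v i • W i x := by
  have : CompleteSpace E := FiniteDimensional.complete ℝ E
  have hV : ∀ u : ι → ℝ, ContDiffOn ℝ 1 (fun y => ∑ i, u i • W i y) Ω := fun u =>
    ContDiffOn.sum fun i _ => ((hW i).of_le (by simp)).const_smul (u i)
  obtain ⟨ε, hε, hball⟩ := Metric.isOpen_iff.1 hΩ x hx
  -- The cutoff is supported inside Ω, so the fields extend smoothly to E. It equals 1 on the ball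
  -- of radius ε/4, where the curves stay for small u, so they also solve the original equation.
  let χ : ContDiffBump x := ⟨ε / 4, ε / 2, by positivity, by linarith⟩
  let Z : ι → E → E := fun i y => χ y • W i y
  have hZ : ∀ i, ContDiff ℝ ∞ (Z i) := fun i => contDiff_iff_contDiffAt.2 fun y => by
    by_cases hy : y ∈ Ω
    · exact χ.contDiffAt.smul ((hW i).contDiffAt (hΩ.mem_nhds hy))
    · have hy' : y ∉ tsupport χ := fun h => hy <| hball <| by
        rw [χ.tsupport_eq, Metric.mem_closedBall] at h
        rw [Metric.mem_ball]
        have : dist y x ≤ ε / 2 := h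
        linarith
      have h0 : Z i =ᶠ[𝓝 y] fun _ => 0 := by
        filter_upwards [notMem_tsupport_iff_eventuallyEq.1 hy'] with z hz
        simp [Z, hz]
      exact contDiffAt_const.congr_of_eventuallyEq h0
  obtain ⟨φ, hφ0, hφs, hφ⟩ := exists_smooth_solution Z hZ x
  have hnear : ∀ᶠ u in 𝓝 (0 : ι → ℝ), dist (φ u) (ContinuousMap.const _ x) < ε / 4 := by
    have : ContinuousAt φ 0 := hφs.self_of_nhds.continuousAt
    have h2 := this.tendsto
    rw [hφ0] at h2
    exact h2.eventually (Metric.ball_mem_nhds _ (by positivity))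
  have hsol : ∀ᶠ u in 𝓝 (0 : ι → ℝ), ∃ γ : ℝ → E, γ 0 = x ∧ γ 1 = φ u 1 ∧
      ∀ t ∈ Icc (0 : ℝ) 1, γ t ∈ Ω ∧
        HasDerivWithinAt γ ((fun y => ∑ i, u i • W i y) (γ t)) (Icc 0 1) t := by
    filter_upwards [hφ, hnear] with u hu hn
    refine ⟨fun t => x + ∫ s in (0 : ℝ)..t, ∑ i, u i • Z i (extendCurve (φ u) s), by simp,
      (hu 1).symm, fun t ht => ?_⟩
    have hγ : x + ∫ s in (0 : ℝ)..t, ∑ i, u i • Z i (extendCurve (φ u) s) = φ u ⟨t, ht⟩ :=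
      (hu ⟨t, ht⟩).symm
    have hd : dist (φ u ⟨t, ht⟩) x < ε / 4 :=
      (ContinuousMap.dist_apply_le_dist (g := ContinuousMap.const _ x) _).trans_lt hn
    have hc : Continuous fun s => ∑ i, u i • Z i (extendCurve (φ u) s) :=
      continuous_finsetSum _ fun i _ =>
        ((hZ i).continuous.comp (continuous_extendCurve _)).const_smul _
    beta_reduce
    rw [hγ]
    refine ⟨hball (by rw [Metric.mem_ball]; linarith), ?_⟩
    have h1 := ((hc.integral_hasStrictDerivAt 0 t).hasDerivAt.const_add x).hasDerivWithinAt
      (s := Icc 0 1)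
    have h2 : χ (φ u ⟨t, ht⟩) = 1 := χ.one_of_mem_closedBall (Metric.mem_closedBall.2 hd.le)
    rw [extendCurve_of_mem _ ht] at h1
    simpa [Z, h2] using h1
  have heq : ∀ᶠ u in 𝓝 (0 : ι → ℝ), Φ u = φ u 1 ∧
      IsExp Ω (fun y => ∑ i, u i • W i y) x (Φ u) := by
    filter_upwards [hsol] with u ⟨γ, h0, h1, hγ⟩
    have hexp : IsExp Ω (fun y => ∑ i, u i • W i y) x (φ u 1) := ⟨γ, h0, h1, hγ⟩
    have := (hΦ u).trans (expField_eq hΩ (hV u) hexp)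
    exact ⟨this, this ▸ hexp⟩
  have hsmooth : ∀ᶠ u in 𝓝 (0 : ι → ℝ), ContDiffAt ℝ ∞ Φ u := by
    filter_upwards [heq.eventually_nhds, hφs] with u h1 h2
    have h3 : ContDiffAt ℝ ∞ (fun u => φ u 1) u :=
      (ContinuousMap.evalCLM ℝ (1 : Icc (0 : ℝ) 1) :
        C(Icc (0 : ℝ) 1, E) →L[ℝ] E).contDiff.contDiffAt.comp u h2
    exact h3.congr_of_eventuallyEq (h1.mono fun _ h => h.1)
  have hray : ∀ᶠ u in 𝓝 (0 : ι → ℝ), ∃ γ : ℝ → E, γ 0 = x ∧ γ 1 = Φ u ∧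
      ∀ t ∈ Icc (0 : ℝ) 1, Φ (t • u) = γ t ∧
        HasDerivWithinAt γ (∑ i, u i • W i (γ t)) (Icc 0 1) t := by
    filter_upwards [hsol, heq] with u ⟨γ, h0, h1, hγ⟩ h2
    refine ⟨γ, h0, h1.trans h2.1.symm, fun t ht => ⟨?_, (hγ t ht).2⟩⟩
    rw [hΦ]
    refine expField_eq hΩ (hV _) ?_
    have := IsExp.smul (V := fun y => ∑ i, u i • W i y) h0 hγ ht
    simpa [Finset.smul_sum, smul_smul] using this
  have hΦ0 : Φ 0 = x := by
    rw [heq.self_of_nhds.1, hφ0]; rfl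
  have hderiv : ∀ {u : ι → ℝ} {γ : ℝ → E} {t : ℝ}, t ∈ Icc (0 : ℝ) 1 →
      (∀ t ∈ Icc (0 : ℝ) 1, Φ (t • u) = γ t ∧
        HasDerivWithinAt γ (∑ i, u i • W i (γ t)) (Icc 0 1) t) →
      DifferentiableAt ℝ Φ (t • u) → fderiv ℝ Φ (t • u) u = ∑ i, u i • W i (Φ (t • u)) := by
    intro u γ t ht hγ hd
    have h1 : HasDerivAt (fun t : ℝ => t • u) u t := by
      simpa using (hasDerivAt_id t).smul_const u
    have h2 : HasDerivWithinAt (fun t : ℝ => Φ (t • u)) (fderiv ℝ Φ (t • u) u) (Icc 0 1) t :=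
      (hd.hasFDerivAt.comp_hasDerivAt t h1).hasDerivWithinAt
    have h3 : HasDerivWithinAt (fun t : ℝ => Φ (t • u)) (∑ i, u i • W i (γ t)) (Icc 0 1) t :=
      (hγ t ht).2.congr (fun s hs => (hγ s hs).1) (hγ t ht).1
    rw [(hγ t ht).1]
    exact (uniqueDiffOn_Icc zero_lt_one t ht).eq_deriv _ h2 h3
  refine ⟨?_, hΦ0, fun v => ?_⟩
  · filter_upwards [heq, hsmooth, hray] with u h1 h2 ⟨γ, _, _, hγ⟩
    refine ⟨h1.2, h2, ?_⟩
    have := hderiv (right_mem_Icc.2 zero_le_one) hγ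
      (by rw [one_smul]; exact h2.differentiableAt (by simp))
    rwa [one_smul] at this
  -- The vector v need not be small: the ray formula at t = 0 is used for cv with a small c ≠ 0,
  -- which linearity then cancels.
  · have ht : Filter.Tendsto (fun c : ℝ => c • v) (𝓝[≠] 0) (𝓝 0) :=
      (Continuous.tendsto' (by fun_prop) _ _ (by simp)).mono_left nhdsWithin_le_nhds
    obtain ⟨c, ⟨γ, _, _, hγ⟩, hc⟩ :=
      ((ht.eventually hray).and (eventually_mem_nhdsWithin)).exists
    have hc : c ≠ 0 := hc
    have := hderiv (left_mem_Icc.2 zero_le_one) hγ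
      (by rw [zero_smul]; exact hsmooth.self_of_nhds.differentiableAt (by simp))
    rw [zero_smul, map_smul, hΦ0] at this
    simp only [Pi.smul_apply, smul_assoc, ← Finset.smul_sum] at this
    exact smul_right_injective E hc this

end Exponential

/-! ### Formal commutators, differential operators and the use of freeness -/

section Algebra

open Set VectorField

variable {n : ℕ}

theorem weight_cons (i : Fin (n + 1)) (I : MultiIndex n) :
    weight (i :: I) = indexWeight i + weight I := by
  simp [weight]

theorem formalCommutator_cons (i : Fin (n + 1)) {I : MultiIndex n} (hI : I ≠ []) :
    formalCommutator (i :: I) = MonoidAlgebra.of ℝ _ (FreeMonoid.of i) * formalCommutator I -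
      formalCommutator I * MonoidAlgebra.of ℝ _ (FreeMonoid.of i) := by
  cases I with
  | nil => exact absurd rfl hI
  | cons j I => rfl

/-- The noncommutative polynomials that are homogeneous of weight `w`. -/
noncomputable def homogeneousPart (n w : ℕ) :
    Submodule ℝ (MonoidAlgebra ℝ (FreeMonoid (Fin (n + 1)))) :=
  Submodule.span ℝ {p | ∃ J : MultiIndex n, weight J = w ∧
    p = MonoidAlgebra.of ℝ _ (FreeMonoid.ofList J)}

theorem of_mul_mem_homogeneousPart {w : ℕ} (i : Fin (n + 1))
    {q : MonoidAlgebra ℝ (FreeMonoid (Fin (n + 1)))} (hq : q ∈ homogeneousPart n w) :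
    MonoidAlgebra.of ℝ _ (FreeMonoid.of i) * q ∈ homogeneousPart n (indexWeight i + w) := by
  induction hq using Submodule.span_induction with
  | mem q hq =>
    obtain ⟨J, rfl, rfl⟩ := hq
    refine Submodule.subset_span ⟨i :: J, weight_cons i J, ?_⟩
    rw [← map_mul]
    rfl
  | zero => simp
  | add a b _ _ ha hb => rw [mul_add]; exact add_mem ha hb
  | smul c a _ ha => rw [mul_smul_comm]; exact Submodule.smul_mem _ _ ha

theorem mul_of_mem_homogeneousPart {w : ℕ} (i : Fin (n + 1))
    {q : MonoidAlgebra ℝ (FreeMonoid (Fin (n + 1)))} (hq : q ∈ homogeneousPart n w) :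
    q * MonoidAlgebra.of ℝ _ (FreeMonoid.of i) ∈ homogeneousPart n (indexWeight i + w) := by
  induction hq using Submodule.span_induction with
  | mem q hq =>
    obtain ⟨J, rfl, rfl⟩ := hq
    refine Submodule.subset_span ⟨J ++ [i], by simp [weight, add_comm], ?_⟩
    rw [← map_mul]
    rfl
  | zero => simp
  | add a b _ _ ha hb => rw [add_mul]; exact add_mem ha hb
  | smul c a _ ha => rw [smul_mul_assoc]; exact Submodule.smul_mem _ _ ha

theorem formalCommutator_mem_homogeneousPart (I : MultiIndex n) :
    formalCommutator I ∈ homogeneousPart n (weight I) := by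
  induction I with
  | nil => exact zero_mem _
  | cons i I ih =>
    rcases eq_or_ne I [] with rfl | hI
    · exact Submodule.subset_span ⟨[i], rfl, rfl⟩
    · rw [formalCommutator_cons i hI, weight_cons]
      exact sub_mem (of_mul_mem_homogeneousPart i ih) (mul_of_mem_homogeneousPart i ih)

theorem coeff_eq_zero_of_mem_homogeneousPart {w : ℕ}
    {q : MonoidAlgebra ℝ (FreeMonoid (Fin (n + 1)))} (hq : q ∈ homogeneousPart n w)
    {J : MultiIndex n} (hJ : weight J ≠ w) : q.coeff (FreeMonoid.ofList J) = 0 := by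
  induction hq using Submodule.span_induction with
  | mem q hq =>
    obtain ⟨J', rfl, rfl⟩ := hq
    have : FreeMonoid.ofList J' ≠ FreeMonoid.ofList J := fun h =>
      hJ (congrArg weight (FreeMonoid.ofList.injective h)).symm
    simp [MonoidAlgebra.of_apply, this]
  | zero => simp
  | add a b _ _ ha hb => simp [ha, hb]
  | smul c a _ ha => simp [ha]

theorem commCoeff_eq_zero {I J : MultiIndex n} (h : weight J ≠ weight I) : commCoeff I J = 0 :=
  coeff_eq_zero_of_mem_homogeneousPart (formalCommutator_mem_homogeneousPart I) h

variable {E : Type*} [NormedAddCommGroup E] [NormedSpace ℝ E]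

theorem iterBracket_cons (X : Fin (n + 1) → E → E) (i : Fin (n + 1)) {I : MultiIndex n}
    (hI : I ≠ []) : iterBracket X (i :: I) = lieBracket ℝ (X i) (iterBracket X I) := by
  cases I with
  | nil => exact absurd rfl hI
  | cons j I => rfl

theorem minSmoothness_two_le_infty : minSmoothness ℝ 2 ≤ ∞ := by
  rw [minSmoothness_of_isRCLikeNormedField]
  exact ENat.LEInfty.out

theorem contDiffOn_lieBracket [CompleteSpace E] {Ω : Set E} (hΩ : IsOpen Ω) {V W : E → E}
    (hV : ContDiffOn ℝ ∞ V Ω) (hW : ContDiffOn ℝ ∞ W Ω) :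
    ContDiffOn ℝ ∞ (lieBracket ℝ V W) Ω := fun _ hx =>
  ((hV.contDiffAt (hΩ.mem_nhds hx)).lieBracket_vectorField (hW.contDiffAt (hΩ.mem_nhds hx))
    (by simp)).contDiffWithinAt

theorem contDiffOn_iterBracket [CompleteSpace E] {Ω : Set E} (hΩ : IsOpen Ω)
    {X : Fin (n + 1) → E → E}
    (hX : ∀ i, ContDiffOn ℝ ∞ (X i) Ω) (I : MultiIndex n) :
    ContDiffOn ℝ ∞ (iterBracket X I) Ω := by
  induction I with
  | nil => exact contDiffOn_const
  | cons i I ih =>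
    rcases eq_or_ne I [] with rfl | hI
    · exact hX i
    · rw [iterBracket_cons X i hI]
      exact contDiffOn_lieBracket hΩ (hX i) ih

/-- The functions that are smooth on `Ω`. -/
def smoothOn (Ω : Set E) : Submodule ℝ (E → ℝ) where
  carrier := {f | ContDiffOn ℝ ∞ f Ω}
  add_mem' := fun ha hb => ContDiffOn.add ha hb
  zero_mem' := contDiffOn_const
  smul_mem' := fun c _ hf => ContDiffOn.const_smul c hf

/-- A smooth field as a linear operator on the functions that are smooth on `Ω`. -/
noncomputable def derivationOn {Ω : Set E} (hΩ : IsOpen Ω) (V : E → E)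
    (hV : ContDiffOn ℝ ∞ V Ω) : Module.End ℝ (smoothOn Ω) where
  -- Off Ω the functions need not be differentiable and `fderiv` need not be additive; cutting the
  -- result to 0 there makes the operator linear.
  toFun f := ⟨Ω.indicator fun x => fderiv ℝ f.1 x (V x), by
    have h : ContDiffOn ℝ ∞ (fun x => fderiv ℝ f.1 x (V x)) Ω :=
      (f.2.fderiv_of_isOpen hΩ (by simp)).clm_apply hV
    exact h.congr fun x hx => indicator_of_mem hx _⟩
  map_add' f g := by
    ext x
    by_cases hx : x ∈ Ω
    · have hf := (f.2.contDiffAt (hΩ.mem_nhds hx)).differentiableAt (by simp)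
      have hg := (g.2.contDiffAt (hΩ.mem_nhds hx)).differentiableAt (by simp)
      simp [hx, fderiv_add hf hg]
    · simp [hx]
  map_smul' c f := by
    ext x
    by_cases hx : x ∈ Ω
    · have hf := (f.2.contDiffAt (hΩ.mem_nhds hx)).differentiableAt (by simp)
      simp [hx, fderiv_const_smul hf]
    · simp [hx]

theorem derivationOn_apply {Ω : Set E} (hΩ : IsOpen Ω) {V : E → E} (hV : ContDiffOn ℝ ∞ V Ω)
    (f : smoothOn Ω) {x : E} (hx : x ∈ Ω) :
    (derivationOn hΩ V hV f).1 x = fderiv ℝ f.1 x (V x) := by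
  change Ω.indicator (fun x => fderiv ℝ f.1 x (V x)) x = _
  rw [indicator_of_mem hx]

/-- The action of noncommutative polynomials as differential operators. -/
noncomputable def diffOp {Ω : Set E} (hΩ : IsOpen Ω) {X : Fin (n + 1) → E → E}
    (hX : ∀ i, ContDiffOn ℝ ∞ (X i) Ω) :
    MonoidAlgebra ℝ (FreeMonoid (Fin (n + 1))) →ₐ[ℝ] Module.End ℝ (smoothOn Ω) :=
  MonoidAlgebra.lift ℝ _ _ (FreeMonoid.lift fun i => derivationOn hΩ (X i) (hX i))

theorem diffOp_of {Ω : Set E} (hΩ : IsOpen Ω) {X : Fin (n + 1) → E → E}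
    (hX : ∀ i, ContDiffOn ℝ ∞ (X i) Ω) (i : Fin (n + 1)) :
    diffOp hΩ hX (MonoidAlgebra.of ℝ _ (FreeMonoid.of i)) = derivationOn hΩ (X i) (hX i) := by
  simp [diffOp]

/-- Induction on the commutator with [V, W]f = V(Wf) − W(Vf). This links the formal constants A_{IJ}
to the actual brackets. -/
theorem diffOp_formalCommutator [CompleteSpace E] {Ω : Set E} (hΩ : IsOpen Ω)
    {X : Fin (n + 1) → E → E}
    (hX : ∀ i, ContDiffOn ℝ ∞ (X i) Ω) {I : MultiIndex n} (hI : I ≠ []) (f : smoothOn Ω) {x : E}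
    (hx : x ∈ Ω) :
    (diffOp hΩ hX (formalCommutator I) f).1 x = fderiv ℝ f.1 x (iterBracket X I x) := by
  induction I generalizing f x with
  | nil => exact absurd rfl hI
  | cons i I ih =>
    rcases eq_or_ne I [] with rfl | hI
    · change (diffOp hΩ hX (MonoidAlgebra.of ℝ _ (FreeMonoid.of i)) f).1 x = _
      rw [diffOp_of, derivationOn_apply hΩ _ _ hx]
      rfl
    · have hXi := (hX i).contDiffAt (hΩ.mem_nhds hx)
      have hXI := (contDiffOn_iterBracket hΩ hX I).contDiffAt (hΩ.mem_nhds hx)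
      have hf := f.2.contDiffAt (hΩ.mem_nhds hx)
      rw [formalCommutator_cons i hI, iterBracket_cons X i hI,
        fderiv_apply_lieBracket hf minSmoothness_two_le_infty (hXI.differentiableAt (by simp))
          (hXi.differentiableAt (by simp)), map_sub, map_mul, map_mul, diffOp_of]
      have h1 : (diffOp hΩ hX (formalCommutator I) f).1 =ᶠ[𝓝 x]
          fun y => fderiv ℝ f.1 y (iterBracket X I y) := by
        filter_upwards [hΩ.mem_nhds hx] with y hy using ih hI f hy
      have h2 : (derivationOn hΩ (X i) (hX i) f).1 =ᶠ[𝓝 x]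
          fun y => fderiv ℝ f.1 y (X i y) := by
        filter_upwards [hΩ.mem_nhds hx] with y hy using derivationOn_apply hΩ _ f hy
      change (derivationOn hΩ (X i) (hX i) (diffOp hΩ hX (formalCommutator I) f)).1 x -
        (diffOp hΩ hX (formalCommutator I) (derivationOn hΩ (X i) (hX i) f)).1 x = _
      rw [derivationOn_apply hΩ _ _ hx, ih hI _ hx, h1.fderiv_eq, h2.fderiv_eq]

/-- A linear relation between formal commutators holds for the commutators of smooth fields. -/
theorem iterBracket_eq_sum_of_formalCommutator [CompleteSpace E] {Ω : Set E} (hΩ : IsOpen Ω)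
    {X : Fin (n + 1) → E → E} (hX : ∀ i, ContDiffOn ℝ ∞ (X i) Ω) {L : MultiIndex n} (hL : L ≠ [])
    {s : Finset (MultiIndex n)} (hs : ∀ K ∈ s, K ≠ []) {c : MultiIndex n → ℝ}
    (h : formalCommutator L = ∑ K ∈ s, c K • formalCommutator K) {x : E} (hx : x ∈ Ω) :
    iterBracket X L x = ∑ K ∈ s, c K • iterBracket X K x := by
  rw [← sub_eq_zero]
  -- Linear functionals suffice as test functions: each is its own derivative, and together they
  -- separate vectors.
  refine SeparatingDual.eq_zero_of_forall_dual_eq_zero (R := ℝ) fun ℓ => ?_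
  let f : smoothOn Ω := ⟨ℓ, ℓ.contDiff.contDiffOn⟩
  have hℓ : ∀ {I : MultiIndex n}, I ≠ [] →
      (diffOp hΩ hX (formalCommutator I) f).1 x = ℓ (iterBracket X I x) := fun hI => by
    rw [diffOp_formalCommutator hΩ hX hI f hx]
    simp [f]
  have h1 := congrArg (fun q => (diffOp hΩ hX q f).1 x) h
  simp only [map_sum, map_smul] at h1
  rw [hℓ hL] at h1
  rw [map_sub, h1, map_sum, sub_eq_zero, LinearMap.sum_apply]
  simp only [AddSubmonoidClass.coe_finsetSum, Finset.sum_apply]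
  refine Finset.sum_congr rfl fun K hK => ?_
  rw [map_smul, ← hℓ (hs K hK)]
  rfl

theorem sum_single_sub_sum_single {ι M : Type*} [AddCommGroup M] [Module ℝ M] (L : ι)
    (B : Finset ι) (c : ι → ℝ) (g : ι → M) :
    ((Finsupp.single L (1 : ℝ) - ∑ K ∈ B, Finsupp.single K (c K)).sum fun I t => t • g I) =
      g L - ∑ K ∈ B, c K • g K := by
  change Finsupp.linearCombination ℝ g _ = _
  simp

/-- For fields that are free up to weight `r`, each commutator of weight at most `r` is a constant
combination of the commutators of the same weight in a basis. -/
theorem iterBracket_eq_sum_basis [CompleteSpace E] {Ω : Set E} (hΩ : IsOpen Ω)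
    {X : Fin (n + 1) → E → E} (hX : ∀ i, ContDiffOn ℝ ∞ (X i) Ω) {r : ℕ} {x : E}
    (hfree : IsFreeUpToWeight X r x) {B : Finset (MultiIndex n)}
    (hBr : ∀ I ∈ B, I ≠ [] ∧ weight I ≤ r)
    (hspan : Submodule.span ℝ (Set.range (fun I : B => iterBracket X I.1 x)) = ⊤)
    {L : MultiIndex n} (hL : L ≠ []) (hLr : weight L ≤ r) :
    ∃ c : MultiIndex n → ℝ, ∀ y ∈ Ω, iterBracket X L y =
      ∑ K ∈ B with weight K = weight L, c K • iterBracket X K y := by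
  classical
  have hmem : iterBracket X L x ∈
      Submodule.span ℝ (Set.range (fun I : B => iterBracket X I.1 x)) := hspan ▸ trivial
  obtain ⟨d, hd⟩ := (Submodule.mem_span_range_iff_exists_fun ℝ).1 hmem
  let c : MultiIndex n → ℝ := fun K => if h : K ∈ B then d ⟨K, h⟩ else 0
  have hc : ∑ K ∈ B, c K • iterBracket X K x = iterBracket X L x := by
    rw [← hd, ← Finset.sum_coe_sort B]
    exact Finset.sum_congr rfl fun K _ => by simp [c]
  -- The relation at the single point x, to which freeness is applied; L itself may belong to B.
  let a : MultiIndex n →₀ ℝ := Finsupp.single L 1 - ∑ K ∈ B, Finsupp.single K (c K)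
  have hsupp : ∀ I ∈ a.support, I ≠ [] ∧ weight I ≤ r := by
    intro I hI
    by_cases hIB : I ∈ B
    · exact hBr I hIB
    · by_cases hIL : I = L
      · exact hIL ▸ ⟨hL, hLr⟩
      · refine absurd ?_ (Finsupp.mem_support_iff.1 hI)
        have h2 : ∀ K ∈ B, Finsupp.single K (c K) I = 0 := fun K hK =>
          Finsupp.single_eq_of_ne fun h => hIB (h ▸ hK)
        simp [a, Finset.sum_eq_zero h2, hIL]
  have hrel := hfree a hsupp (by rw [sum_single_sub_sum_single, hc, sub_self])
  have hrel' : ∀ J, commCoeff L J = ∑ K ∈ B, c K * commCoeff K J := fun J => by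
    have h1 := hrel J
    have h2 := sum_single_sub_sum_single L B c (fun I => commCoeff I J)
    simp only [smul_eq_mul] at h2
    exact sub_eq_zero.1 (h2.symm.trans h1)
  refine ⟨c, fun y hy => iterBracket_eq_sum_of_formalCommutator hΩ hX hL
    (fun K hK => (hBr K (Finset.mem_filter.1 hK).1).1) ?_ hy⟩
  ext J
  have hcoef : (∑ K ∈ B with weight K = weight L, c K • formalCommutator K).coeff J =
      ∑ K ∈ B with weight K = weight L, c K * commCoeff K J.toList := by
    rw [MonoidAlgebra.coeff_sum, Finsupp.finsetSum_apply]
    rfl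
  rw [hcoef]
  change commCoeff L J.toList = _
  -- On words of weight |L| only the K with |K| = |L| contribute; on other words both sides vanish.
  -- So terms of other weights may be dropped.
  by_cases hJ : weight J.toList = weight L
  · rw [hrel', Finset.sum_filter_of_ne]
    intro K _ hK
    by_contra hne
    exact hK (by rw [commCoeff_eq_zero fun h => hne (h.symm.trans hJ), mul_zero])
  · rw [commCoeff_eq_zero hJ]
    refine (Finset.sum_eq_zero fun K hK => ?_).symm
    rw [commCoeff_eq_zero fun h => hJ (h.trans (Finset.mem_filter.1 hK).2), mul_zero]

/-- The fields that agree on `Ω` with a constant combination of commutators of weight `w`. -/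
def commutatorSpan (Ω : Set E) (X : Fin (n + 1) → E → E) (w : ℕ) : Submodule ℝ (E → E) where
  carrier := {V | ∃ W ∈ Submodule.span ℝ {W | ∃ L : MultiIndex n, L ≠ [] ∧ weight L = w ∧
    W = iterBracket X L}, EqOn V W Ω}
  add_mem' := by
    rintro V V' ⟨W, hW, h⟩ ⟨W', hW', h'⟩
    exact ⟨W + W', add_mem hW hW', fun x hx => by simp [h hx, h' hx]⟩
  zero_mem' := ⟨0, zero_mem _, fun _ _ => rfl⟩
  smul_mem' := by
    rintro c V ⟨W, hW, h⟩
    exact ⟨c • W, Submodule.smul_mem _ c hW, fun x hx => by simp [h hx]⟩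

theorem mem_commutatorSpan_congr {Ω : Set E} {X : Fin (n + 1) → E → E} {w : ℕ} {V V' : E → E}
    (h : V ∈ commutatorSpan Ω X w) (hV : EqOn V' V Ω) : V' ∈ commutatorSpan Ω X w := by
  obtain ⟨W, hW, hVW⟩ := h
  exact ⟨W, hW, hV.trans hVW⟩

theorem iterBracket_mem_commutatorSpan {Ω : Set E} {X : Fin (n + 1) → E → E} {L : MultiIndex n}
    (hL : L ≠ []) : iterBracket X L ∈ commutatorSpan Ω X (weight L) :=
  ⟨_, Submodule.subset_span ⟨L, hL, rfl, rfl⟩, fun _ _ => rfl⟩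

theorem lieBracket_mem_commutatorSpan [CompleteSpace E] {Ω : Set E} (hΩ : IsOpen Ω)
    {X : Fin (n + 1) → E → E} (hX : ∀ i, ContDiffOn ℝ ∞ (X i) Ω) (i : Fin (n + 1)) {w : ℕ}
    {V : E → E} (hV : V ∈ commutatorSpan Ω X w) :
    lieBracket ℝ (X i) V ∈ commutatorSpan Ω X (indexWeight i + w) := by
  obtain ⟨W, hW, hVW⟩ := hV
  -- Smoothness is carried along in the induction because the bracket is additive only at points
  -- where the fields are differentiable.
  have key : ContDiffOn ℝ ∞ W Ω ∧
      lieBracket ℝ (X i) W ∈ commutatorSpan Ω X (indexWeight i + w) := by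
    clear hVW
    induction hW using Submodule.span_induction with
    | mem W hW =>
      obtain ⟨L, hL, rfl, rfl⟩ := hW
      refine ⟨contDiffOn_iterBracket hΩ hX L, ?_⟩
      rw [← iterBracket_cons X i hL, ← weight_cons]
      exact iterBracket_mem_commutatorSpan (by simp)
    | zero => exact ⟨contDiffOn_const, by simp⟩
    | add W W' _ _ h h' =>
      refine ⟨h.1.add h'.1, mem_commutatorSpan_congr (add_mem h.2 h'.2) fun x hx => ?_⟩
      exact lieBracket_add_right
        ((h.1.contDiffAt (hΩ.mem_nhds hx)).differentiableAt (by simp))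
        ((h'.1.contDiffAt (hΩ.mem_nhds hx)).differentiableAt (by simp))
    | smul c W _ h =>
      refine ⟨h.1.const_smul c, mem_commutatorSpan_congr (Submodule.smul_mem _ c h.2)
        fun x hx => ?_⟩
      exact lieBracket_const_smul_right
        ((h.1.contDiffAt (hΩ.mem_nhds hx)).differentiableAt (by simp))
  refine mem_commutatorSpan_congr key.2 fun x hx => ?_
  exact Filter.EventuallyEq.lieBracket_vectorField_eq Filter.EventuallyEq.rfl
    (hVW.eventuallyEq_of_mem (hΩ.mem_nhds hx))

/-- Jacobi: [[X_i, X_[I]], X_[J]] = [X_i, [X_[I], X_[J]]] − [X_[I], [X_i, X_[J]]]. Induction on I,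
with J free because the last term replaces J by (i, J). -/
theorem lieBracket_iterBracket_mem_commutatorSpan [CompleteSpace E] {Ω : Set E} (hΩ : IsOpen Ω)
    {X : Fin (n + 1) → E → E} (hX : ∀ i, ContDiffOn ℝ ∞ (X i) Ω) {I J : MultiIndex n}
    (hI : I ≠ []) (hJ : J ≠ []) :
    lieBracket ℝ (iterBracket X I) (iterBracket X J) ∈
      commutatorSpan Ω X (weight I + weight J) := by
  induction I generalizing J with
  | nil => exact absurd rfl hI
  | cons i I ih =>
    rcases eq_or_ne I [] with rfl | hI
    · exact lieBracket_mem_commutatorSpan hΩ hX i (iterBracket_mem_commutatorSpan hJ)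
    · have h1 := lieBracket_mem_commutatorSpan hΩ hX i (ih hI hJ)
      have h2 := ih (J := i :: J) hI (by simp)
      rw [weight_cons, ← add_assoc, add_comm (weight I), ← weight_cons] at h2
      rw [← add_assoc, ← weight_cons] at h1
      refine mem_commutatorSpan_congr (sub_mem h1 h2) fun x hx => ?_
      have hs : ∀ L, ContDiffAt ℝ ∞ (iterBracket X L) x := fun L =>
        (contDiffOn_iterBracket hΩ hX L).contDiffAt (hΩ.mem_nhds hx)
      have := leibniz_identity_lieBracket minSmoothness_two_le_infty
        ((hX i).contDiffAt (hΩ.mem_nhds hx)) (hs I) (hs J)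
      rw [Pi.sub_apply, this, iterBracket_cons X i hI, iterBracket_cons X i hJ]
      abel

theorem eq_sum_basis_of_mem_commutatorSpan [CompleteSpace E] {Ω : Set E} (hΩ : IsOpen Ω)
    {X : Fin (n + 1) → E → E} (hX : ∀ i, ContDiffOn ℝ ∞ (X i) Ω) {r : ℕ} {x : E}
    (hfree : IsFreeUpToWeight X r x) {B : Finset (MultiIndex n)}
    (hBr : ∀ I ∈ B, I ≠ [] ∧ weight I ≤ r)
    (hspan : Submodule.span ℝ (Set.range (fun I : B => iterBracket X I.1 x)) = ⊤)
    {w : ℕ} (hw : w ≤ r) {V : E → E} (hV : V ∈ commutatorSpan Ω X w) :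
    ∃ c : MultiIndex n → ℝ, ∀ y ∈ Ω, V y =
      ∑ K ∈ B with weight K = w, c K • iterBracket X K y := by
  obtain ⟨W, hW, hVW⟩ := hV
  suffices h : ∃ c : MultiIndex n → ℝ, ∀ y ∈ Ω, W y =
      ∑ K ∈ B with weight K = w, c K • iterBracket X K y by
    obtain ⟨c, hc⟩ := h
    exact ⟨c, fun y hy => (hVW hy).trans (hc y hy)⟩
  clear hVW
  induction hW using Submodule.span_induction with
  | mem W hW =>
    obtain ⟨L, hL, rfl, rfl⟩ := hW
    exact iterBracket_eq_sum_basis hΩ hX hfree hBr hspan hL hw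
  | zero => exact ⟨0, by simp⟩
  | add W W' _ _ h h' =>
    obtain ⟨c, hc⟩ := h
    obtain ⟨c', hc'⟩ := h'
    refine ⟨c + c', fun y hy => ?_⟩
    simp [hc y hy, hc' y hy, add_smul, Finset.sum_add_distrib]
  | smul a W _ h =>
    obtain ⟨c, hc⟩ := h
    refine ⟨a • c, fun y hy => ?_⟩
    simp [hc y hy, Finset.smul_sum, smul_smul]

end Algebra

/-! ### Taylor coefficients at the origin and the weight induction -/

section Germs

open Filter

variable {ι : Type*} [Fintype ι]

/-- Smoothness in a neighbourhood of the origin. -/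
def SmoothNear (f : (ι → ℝ) → ℝ) : Prop := ∀ᶠ u in 𝓝 (0 : ι → ℝ), ContDiffAt ℝ ∞ f u

theorem SmoothNear.add {f g : (ι → ℝ) → ℝ} (hf : SmoothNear f) (hg : SmoothNear g) :
    SmoothNear fun u => f u + g u := by
  filter_upwards [hf, hg] with u h1 h2 using h1.add h2

theorem SmoothNear.mul {f g : (ι → ℝ) → ℝ} (hf : SmoothNear f) (hg : SmoothNear g) :
    SmoothNear fun u => f u * g u := by
  filter_upwards [hf, hg] with u h1 h2 using h1.mul h2

theorem smoothNear_const (c : ℝ) : SmoothNear fun _ : ι → ℝ => c :=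
  Eventually.of_forall fun _ => contDiffAt_const

theorem smoothNear_coord (i : ι) : SmoothNear fun u : ι → ℝ => u i :=
  Eventually.of_forall fun _ => (contDiff_apply ℝ ℝ i).contDiffAt

theorem SmoothNear.const_mul {f : (ι → ℝ) → ℝ} (hf : SmoothNear f) (c : ℝ) :
    SmoothNear fun u => c * f u :=
  (smoothNear_const c).mul hf

theorem SmoothNear.sum {κ : Type*} {s : Finset κ} {f : κ → (ι → ℝ) → ℝ}
    (hf : ∀ k ∈ s, SmoothNear (f k)) : SmoothNear fun u => ∑ k ∈ s, f k u := by
  have : ∀ᶠ u in 𝓝 (0 : ι → ℝ), ∀ k ∈ s, ContDiffAt ℝ ∞ (f k) u :=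
    (Filter.eventually_all_finset s).2 hf
  filter_upwards [this] with u hu using ContDiffAt.sum hu

theorem SmoothNear.differentiable {f : (ι → ℝ) → ℝ} (hf : SmoothNear f) :
    ∀ᶠ u in 𝓝 (0 : ι → ℝ), DifferentiableAt ℝ f u :=
  hf.mono fun _ h => h.differentiableAt (by simp)

theorem SmoothNear.fderiv {f : (ι → ℝ) → ℝ} (hf : SmoothNear f) :
    ∀ᶠ u in 𝓝 (0 : ι → ℝ), ContDiffAt ℝ ∞ (fderiv ℝ f) u :=
  hf.mono fun _ h => h.fderiv_right (by simp)

theorem SmoothNear.euler {f : (ι → ℝ) → ℝ} (hf : SmoothNear f) :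
    SmoothNear fun u => _root_.fderiv ℝ f u u := by
  filter_upwards [hf.fderiv] with u hu using hu.clm_apply contDiffAt_id

variable [DecidableEq ι]

/-- The partial derivative with respect to the coordinate `i`. -/
noncomputable def pderivAt (i : ι) (f : (ι → ℝ) → ℝ) : (ι → ℝ) → ℝ :=
  fun u => fderiv ℝ f u (Pi.single i 1)

/-- The iterated partial derivative along a list of coordinates. -/
noncomputable def iterPderiv : List ι → ((ι → ℝ) → ℝ) → (ι → ℝ) → ℝ
  | [], f => f
  | i :: L, f => iterPderiv L (pderivAt i f)

theorem SmoothNear.pderivAt {f : (ι → ℝ) → ℝ} (hf : SmoothNear f) (i : ι) :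
    SmoothNear (pderivAt i f) := by
  filter_upwards [hf.fderiv] with u hu using hu.clm_apply contDiffAt_const

theorem pderivAt_congr {f g : (ι → ℝ) → ℝ} (h : f =ᶠ[𝓝 0] g) (i : ι) :
    pderivAt i f =ᶠ[𝓝 0] pderivAt i g := by
  filter_upwards [h.fderiv (𝕜 := ℝ)] with u hu
  simp [pderivAt, hu]

theorem iterPderiv_congr (L : List ι) {f g : (ι → ℝ) → ℝ} (h : f =ᶠ[𝓝 0] g) :
    iterPderiv L f 0 = iterPderiv L g 0 := by
  induction L generalizing f g with
  | nil => exact h.self_of_nhds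
  | cons i L ih => exact ih (pderivAt_congr h i)

theorem iterPderiv_add (L : List ι) {f g : (ι → ℝ) → ℝ} (hf : SmoothNear f)
    (hg : SmoothNear g) :
    iterPderiv L (fun u => f u + g u) 0 = iterPderiv L f 0 + iterPderiv L g 0 := by
  induction L generalizing f g with
  | nil => rfl
  | cons i L ih =>
    refine (iterPderiv_congr L ?_).trans (ih (hf.pderivAt i) (hg.pderivAt i))
    filter_upwards [hf.differentiable, hg.differentiable] with u h1 h2
    simp [pderivAt, fderiv_fun_add h1 h2]

theorem iterPderiv_zero (L : List ι) : iterPderiv L (fun _ => 0) (0 : ι → ℝ) = 0 := by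
  induction L with
  | nil => rfl
  | cons i L ih =>
    refine (iterPderiv_congr L ?_).trans ih
    exact Eventually.of_forall fun u => by simp [pderivAt]

theorem iterPderiv_const {L : List ι} (hL : L ≠ []) (c : ℝ) :
    iterPderiv L (fun _ => c) (0 : ι → ℝ) = 0 := by
  cases L with
  | nil => exact absurd rfl hL
  | cons i L =>
    refine (iterPderiv_congr L ?_).trans (iterPderiv_zero L)
    exact Eventually.of_forall fun u => by simp [pderivAt]

theorem iterPderiv_const_mul (L : List ι) {f : (ι → ℝ) → ℝ} (hf : SmoothNear f) (c : ℝ) :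
    iterPderiv L (fun u => c * f u) 0 = c * iterPderiv L f 0 := by
  induction L generalizing f with
  | nil => rfl
  | cons i L ih =>
    refine (iterPderiv_congr L ?_).trans (ih (hf.pderivAt i))
    filter_upwards [hf.differentiable] with u h1
    simp [pderivAt, fderiv_const_mul h1]

theorem iterPderiv_sum (L : List ι) {κ : Type*} {s : Finset κ} {f : κ → (ι → ℝ) → ℝ}
    (hf : ∀ k ∈ s, SmoothNear (f k)) :
    iterPderiv L (fun u => ∑ k ∈ s, f k u) 0 = ∑ k ∈ s, iterPderiv L (f k) 0 := by
  classical
  induction s using Finset.induction_on with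
  | empty => simpa using iterPderiv_zero L
  | insert k s hk ih =>
    simp only [Finset.sum_insert hk]
    rw [iterPderiv_add L (hf k (by simp)) (SmoothNear.sum fun j hj => hf j (by simp [hj])),
      ih fun j hj => hf j (by simp [hj])]

/-- A derivative of a product vanishes at the origin if in each term of the Leibniz rule one of the
factors does. -/
theorem iterPderiv_mul_eq_zero (L : List ι) {f g : (ι → ℝ) → ℝ} (hf : SmoothNear f)
    (hg : SmoothNear g)
    (h : ∀ L₁ L₂ : List ι, (L₁ ++ L₂).Perm L → iterPderiv L₁ f 0 = 0 ∨ iterPderiv L₂ g 0 = 0) :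
    iterPderiv L (fun u => f u * g u) 0 = 0 := by
  induction L generalizing f g with
  | nil => exact mul_eq_zero.2 (h [] [] (by simp))
  | cons i L ih =>
    have heq : pderivAt i (fun u => f u * g u) =ᶠ[𝓝 0]
        fun u => pderivAt i f u * g u + f u * pderivAt i g u := by
      filter_upwards [hf.differentiable, hg.differentiable] with u h1 h2
      simp [pderivAt, fderiv_fun_mul h1 h2]
      ring
    refine (iterPderiv_congr L heq).trans ?_
    rw [iterPderiv_add L ((hf.pderivAt i).mul hg) (hf.mul (hg.pderivAt i)),
      ih (hf.pderivAt i) hg fun L₁ L₂ hL => h (i :: L₁) L₂ (hL.cons i),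
      ih hf (hg.pderivAt i) fun L₁ L₂ hL =>
        h L₁ (i :: L₂) (List.perm_middle.trans (hL.cons i)), add_zero]

theorem iterPderiv_coord {L : List ι} {i : ι} (hL : L ≠ [i]) :
    iterPderiv L (fun u : ι → ℝ => u i) 0 = 0 := by
  cases L with
  | nil => rfl
  | cons j L =>
    have heq : pderivAt j (fun u : ι → ℝ => u i) = fun _ => (Pi.single j 1 : ι → ℝ) i := by
      funext u
      have : HasFDerivAt (fun u : ι → ℝ => u i)
        (ContinuousLinearMap.proj (R := ℝ) (φ := fun _ : ι => ℝ) i) u := hasFDerivAt_apply i u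
      simp [pderivAt, this.fderiv]
    rw [iterPderiv, heq]
    by_cases hLn : L = []
    · subst hLn
      have : j ≠ i := fun h => hL (by rw [h])
      simp [iterPderiv, Pi.single_eq_of_ne this.symm]
    · exact iterPderiv_const hLn _

/-- Euler's identity for the Taylor coefficients at the origin. -/
theorem iterPderiv_euler (L : List ι) {f : (ι → ℝ) → ℝ} (hf : SmoothNear f) :
    iterPderiv L (fun u => fderiv ℝ f u u) 0 = L.length * iterPderiv L f 0 := by
  induction L generalizing f with
  | nil => simp [iterPderiv]
  | cons i L ih =>
    -- By symmetry of the second derivative, ∂_i R f = R ∂_i f + ∂_i f, so each partial derivative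
    -- contributes one to the factor.
    have heq : pderivAt i (fun u => fderiv ℝ f u u) =ᶠ[𝓝 0]
        fun u => fderiv ℝ (pderivAt i f) u u + pderivAt i f u := by
      filter_upwards [hf, hf.fderiv] with u h0 h1
      have hd := h1.differentiableAt (by simp)
      have hsymm := h0.isSymmSndFDerivAt minSmoothness_two_le_infty
      have e1 : fderiv ℝ (fun u => fderiv ℝ f u u) u (Pi.single i 1) =
          fderiv ℝ (fderiv ℝ f) u (Pi.single i 1) u + fderiv ℝ f u (Pi.single i 1) := by
        rw [fderiv_clm_apply hd differentiableAt_fun_id]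
        simp [add_comm]
      have e2 : fderiv ℝ (fun u => fderiv ℝ f u (Pi.single i 1)) u u =
          fderiv ℝ (fderiv ℝ f) u u (Pi.single i 1) := by
        rw [fderiv_clm_apply hd (differentiableAt_const _)]
        simp
      change fderiv ℝ (fun u => fderiv ℝ f u u) u (Pi.single i 1) =
        fderiv ℝ (fun u => fderiv ℝ f u (Pi.single i 1)) u u + fderiv ℝ f u (Pi.single i 1)
      rw [e1, e2, hsymm]
    refine (iterPderiv_congr L heq).trans ?_
    rw [iterPderiv_add L (hf.pderivAt i).euler (hf.pderivAt i), ih (hf.pderivAt i)]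
    simp [iterPderiv]
    ring

/-- The list is reversed because `iterPderiv` applies its head first, while the recursion for
`iteratedFDeriv` used here makes the last vector the innermost derivative. -/
theorem iteratedFDeriv_eq_iterPderiv {f : (ι → ℝ) → ℝ} (hf : SmoothNear f) {k : ℕ}
    (J : Fin k → ι) :
    iteratedFDeriv ℝ k f 0 (fun i => Pi.single (J i) (1 : ℝ)) =
      iterPderiv (List.ofFn J).reverse f 0 := by
  induction k generalizing f with
  | zero => simp [iterPderiv]
  | succ k ih =>
    rw [iteratedFDeriv_succ_apply_right, List.ofFn_succ', List.concat_eq_append,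
      List.reverse_append]
    change _ = iterPderiv (List.ofFn fun i => J i.castSucc).reverse (pderivAt (J (Fin.last k)) f) 0
    rw [← ih (hf.pderivAt _)]
    have h1 : ContDiffAt ℝ k (fderiv ℝ f) 0 := hf.fderiv.self_of_nhds.of_le (by exact_mod_cast le_top)
    have h2 := (ContinuousLinearMap.apply ℝ ℝ (Pi.single (J (Fin.last k)) 1 :
      ι → ℝ)).iteratedFDeriv_comp_left h1 (i := k) le_rfl
    change _ = iteratedFDeriv ℝ k ((ContinuousLinearMap.apply ℝ ℝ
      (Pi.single (J (Fin.last k)) 1 : ι → ℝ)) ∘ fderiv ℝ f) 0 _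
    rw [h2]
    rfl

/-- A matrix of functions that is the identity at the origin and satisfies the structure equation
of canonical coordinates respects the weights. -/
theorem iterPderiv_eq_zero_of_structureEquation {w : ι → ℕ} {r : ℕ} (hw : ∀ K, w K ≤ r)
    {f : ι → ι → (ι → ℝ) → ℝ} (hf : ∀ J K, SmoothNear (f J K))
    (hf0 : ∀ J K, f J K 0 = if J = K then 1 else 0)
    {h : ι → ι → ι → (ι → ℝ) → ℝ} (hh : ∀ I J K, SmoothNear (h I J K))
    (heq : ∀ J K, (fun u => fderiv ℝ (f J K) u u) =ᶠ[𝓝 0] fun u =>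
      f J K u - ∑ I, f J I u * f I K u + ∑ I, u I * h I J K u)
    (hc : ∀ I J, w I + w J ≤ r → ∃ c : ι → ℝ, (∀ M, c M ≠ 0 → w M = w I + w J) ∧
      ∀ K, h I J K =ᶠ[𝓝 0] fun u => ∑ M, c M * f M K u)
    (L : List ι) (J K : ι) (hL : (L.map w).sum + w J < w K) : iterPderiv L (f J K) 0 = 0 := by
  let δ : ι → ι → ℝ := fun J K => if J = K then 1 else 0
  let g : ι → ι → (ι → ℝ) → ℝ := fun J K u => f J K u + -δ J K
  have hg : ∀ J K, SmoothNear (g J K) := fun J K => (hf J K).add (smoothNear_const _)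
  have hg0 : ∀ J K, g J K 0 = 0 := fun J K => by simp [g, hf0, δ]
  have hfg : ∀ J K, f J K = fun u => g J K u + δ J K := fun J K => by funext u; simp [g]
  have hδ : ∀ (L : List ι) (J K : ι), (L.map w).sum + w J < w K →
      iterPderiv L (fun _ => δ J K) (0 : ι → ℝ) = 0 := by
    intro L J K hL
    have : J ≠ K := by rintro rfl; omega
    simp only [δ, this, if_false]
    exact iterPderiv_zero L
  have hfg' : ∀ (L : List ι) (J K : ι), (L.map w).sum + w J < w K →
      iterPderiv L (f J K) 0 = iterPderiv L (g J K) 0 := by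
    intro L J K hL
    rw [hfg, iterPderiv_add L (hg J K) (smoothNear_const _), hδ L J K hL, add_zero]
  -- With f = g + δ the quadratic term becomes ∑ gg + 2g + δ, so the equation turns into Rg + g = −∑
  -- gg + ∑ u_I h_I. The left side gives the nonzero factor m + 1 in degree m, and since g(0) = 0
  -- the right side involves only lower degrees.
  have hgeq : ∀ J K, (fun u => fderiv ℝ (g J K) u u + g J K u) =ᶠ[𝓝 0] fun u =>
      (∑ I, (-1) * (g J I u * g I K u)) + ∑ I, u I * h I J K u := by
    intro J K
    filter_upwards [heq J K] with u hu
    have e1 : fderiv ℝ (g J K) u = fderiv ℝ (f J K) u := fderiv_add_const _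
    have e2 : ∑ I, f J I u * f I K u = ∑ I, g J I u * g I K u + 2 * g J K u + δ J K := by
      simp only [hfg, add_mul, mul_add, Finset.sum_add_distrib]
      simp [δ]
      ring
    rw [e1, hu, e2, hfg J K, ← Finset.mul_sum]
    ring
  suffices key : ∀ (m : ℕ) (L : List ι), L.length = m → ∀ J K : ι, (L.map w).sum + w J < w K →
      iterPderiv L (g J K) 0 = 0 by
    rw [hfg' L J K hL]
    exact key _ L rfl J K hL
  intro m
  induction m using Nat.strong_induction_on with
  | _ m ih =>
  intro L hm J K hL
  have h1 : ((L.length : ℝ) + 1) * iterPderiv L (g J K) 0 = 0 := by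
    have e := iterPderiv_congr L (hgeq J K)
    rw [iterPderiv_add L (hg J K).euler (hg J K), iterPderiv_euler L (hg J K),
      iterPderiv_add L (SmoothNear.sum fun I _ => ((hg J I).mul (hg I K)).const_mul _)
        (SmoothNear.sum fun I _ => (smoothNear_coord I).mul (hh I J K)),
      iterPderiv_sum L fun I _ => ((hg J I).mul (hg I K)).const_mul _,
      iterPderiv_sum L fun I _ => (smoothNear_coord I).mul (hh I J K)] at e
    rw [add_mul, one_mul, e, Finset.sum_eq_zero, Finset.sum_eq_zero, add_zero]
    · intro I _
      refine iterPderiv_mul_eq_zero L (smoothNear_coord I) (hh I J K) fun L₁ L₂ hP => ?_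
      -- A derivative of u_I at 0 survives only for L₁ = [I]. Then w I + w J < w K ≤ r, so the
      -- bracket hypothesis `hc` applies, and h has one derivative fewer.
      by_cases hL₁ : L₁ = [I]
      · right
        subst hL₁
        have hlen := hP.length_eq
        have hsum := (hP.map w).sum_eq
        simp only [List.singleton_append, List.map_cons, List.sum_cons, List.length_cons] at hlen hsum
        have hK := hw K
        obtain ⟨c, hcw, hcf⟩ := hc I J (by omega)
        rw [iterPderiv_congr L₂ (hcf K), iterPderiv_sum L₂ fun M _ => (hf M K).const_mul _]
        refine Finset.sum_eq_zero fun M _ => ?_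
        rw [iterPderiv_const_mul L₂ (hf M K)]
        by_cases hcM : c M = 0
        · rw [hcM, zero_mul]
        · have hM := hcw M hcM
          rw [hfg' L₂ M K (by omega), ih L₂.length (by omega) L₂ rfl M K (by omega), mul_zero]
      · exact Or.inl (iterPderiv_coord hL₁)
    · intro I _
      rw [iterPderiv_const_mul L ((hg J I).mul (hg I K)), iterPderiv_mul_eq_zero L (hg J I) (hg I K),
        mul_zero]
      intro L₁ L₂ hP
      have hlen := hP.length_eq
      have hsum := (hP.map w).sum_eq
      simp only [List.length_append, List.map_append, List.sum_append] at hlen hsum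
      rcases eq_or_ne L₁ [] with rfl | h₁
      · exact Or.inl (hg0 J I)
      rcases eq_or_ne L₂ [] with rfl | h₂
      · exact Or.inr (hg0 I K)
      have p₁ := List.length_pos_iff.2 h₁
      have p₂ := List.length_pos_iff.2 h₂
      -- Both pieces are now shorter than L. If L₁ has weight at least w I − w J, then L₂ has weight
      -- below w K − w I, so one factor vanishes by induction.
      rcases lt_or_ge ((L₁.map w).sum + w J) (w I) with hlt | hge
      · exact Or.inl (ih L₁.length (by omega) L₁ rfl J I hlt)
      · exact Or.inr (ih L₂.length (by omega) L₂ rfl I K (by omega))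
  exact (mul_eq_zero.1 h1).resolve_left (by positivity)

end Germs

/-! ### Pullback to canonical coordinates and the structure equation -/

section CanonicalCoordinates

open Filter VectorField

variable {E F : Type*} [NormedAddCommGroup E] [NormedSpace ℝ E] [NormedAddCommGroup F]
  [NormedSpace ℝ F]

theorem contDiffAt_pullback [CompleteSpace F] {Φ : F → E} {V : E → E} {u : F}
    (hΦ : ContDiffAt ℝ ∞ Φ u) (hinv : (fderiv ℝ Φ u).IsInvertible)
    (hV : ContDiffAt ℝ ∞ V (Φ u)) : ContDiffAt ℝ ∞ (pullback ℝ Φ V) u := by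
  have h1 : ContDiffAt ℝ ∞ (fun y => (fderiv ℝ Φ y).inverse) u :=
    (hinv.contDiffAt_map_inverse (n := ∞)).comp u (hΦ.fderiv_right (by simp))
  exact h1.clm_apply (hV.comp u hΦ)

theorem pullback_eq_sum {κ : Type*} [Fintype κ] {Φ : F → E} {V : E → E} {W : κ → E → E}
    {c : κ → ℝ} {u : F} (h : V (Φ u) = ∑ k, c k • W k (Φ u)) :
    pullback ℝ Φ V u = ∑ k, c k • pullback ℝ Φ (W k) u := by
  simp [pullback, h]

theorem eq_sum_coe_of_mem_commutatorSpan [CompleteSpace E] {n : ℕ} {Ω : Set E} (hΩ : IsOpen Ω)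
    {X : Fin (n + 1) → E → E} (hX : ∀ i, ContDiffOn ℝ ∞ (X i) Ω) {r : ℕ} {x : E}
    (hfree : IsFreeUpToWeight X r x) {B : Finset (MultiIndex n)}
    (hBr : ∀ I ∈ B, I ≠ [] ∧ weight I ≤ r)
    (hspan : Submodule.span ℝ (Set.range (fun I : B => iterBracket X I.1 x)) = ⊤)
    {w : ℕ} (hw : w ≤ r) {V : E → E} (hV : V ∈ commutatorSpan Ω X w) :
    ∃ c : B → ℝ, (∀ M, c M ≠ 0 → weight M.1 = w) ∧
      ∀ y ∈ Ω, V y = ∑ M : B, c M • iterBracket X M.1 y := by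
  obtain ⟨c, hc⟩ := eq_sum_basis_of_mem_commutatorSpan hΩ hX hfree hBr hspan hw hV
  refine ⟨fun M => if weight M.1 = w then c M.1 else 0, fun M hM => ?_, fun y hy => ?_⟩
  · by_contra h
    simp [h] at hM
  · rw [hc y hy, Finset.sum_filter, ← Finset.sum_coe_sort B]
    refine Finset.sum_congr rfl fun M _ => ?_
    by_cases h : weight M.1 = w <;> simp [h]

/-- If `∑ uᵢ Yᵢ` is the radial field, then the derivative of `Y_j` along the radial field is
given by the commutators of the `Yᵢ`. -/
theorem fderiv_radial {ι : Type*} [Fintype ι] {Y : ι → (ι → ℝ) → ι → ℝ} {u : ι → ℝ}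
    (hY : ∀ i, DifferentiableAt ℝ (Y i) u)
    (hrad : (fun u => ∑ i, u i • Y i u) =ᶠ[𝓝 u] fun u => u) (j : ι) :
    fderiv ℝ (Y j) u u =
      Y j u - ∑ i, Y j u i • Y i u + ∑ i, u i • lieBracket ℝ (Y i) (Y j) u := by
  have hd : HasFDerivAt (fun u : ι → ℝ => ∑ i, u i • Y i u)
      (∑ i, (u i • fderiv ℝ (Y i) u +
        (ContinuousLinearMap.proj (R := ℝ) (φ := fun _ : ι => ℝ) i).smulRight (Y i u))) u :=
    HasFDerivAt.fun_sum fun i _ => (hasFDerivAt_apply i u).smul (hY i).hasFDerivAt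
  -- The identity ∑ u_i Y_i(u) = u is differentiated at u; evaluating on Y_j(u) produces the terms
  -- u_i DY_i(Y_j), which are one half of the brackets.
  have h1 := hd.unique ((hasFDerivAt_id u).congr_of_eventuallyEq hrad)
  have h2 := congrArg (fun A : (ι → ℝ) →L[ℝ] ι → ℝ => A (Y j u)) h1
  simp only [sum_apply, add_apply, smul_apply,
    ContinuousLinearMap.smulRight_apply,
    ContinuousLinearMap.proj_apply, ContinuousLinearMap.id_apply, Finset.sum_add_distrib] at h2
  have h3 : ∑ i, u i • fderiv ℝ (Y j) u (Y i u) = fderiv ℝ (Y j) u u := by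
    have hu : ∑ i, u i • Y i u = u := hrad.self_of_nhds
    rw [← congrArg (fderiv ℝ (Y j) u) hu]
    simp
  simp only [lieBracket, smul_sub, Finset.sum_sub_distrib, h3]
  rw [← sub_eq_zero] at h2 ⊢
  rw [← h2]
  abel

end CanonicalCoordinates

/-! ### Weights of the commutators in canonical coordinates -/

theorem mainTheorem6 (n p r : ℕ)
    (Ω : Set (EuclideanSpace ℝ (Fin p))) (hΩ : IsOpen Ω)
    (X : Fin (n + 1) → EuclideanSpace ℝ (Fin p) → EuclideanSpace ℝ (Fin p))
    (hX : ∀ i, ContDiffOn ℝ ∞ (X i) Ω)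
    (hfree : ∀ x ∈ Ω, IsFreeUpToWeight X r x)
    (B : Finset (MultiIndex n))
    (hBr : ∀ I ∈ B, I ≠ [] ∧ weight I ≤ r)
    (hBasis : ∀ x ∈ Ω, LinearIndependent ℝ (fun I : B => iterBracket X I.1 x) ∧
      Submodule.span ℝ (Set.range (fun I : B => iterBracket X I.1 x)) = ⊤)
    (xbar : EuclideanSpace ℝ (Fin p)) (hxbar : xbar ∈ Ω) :
    -- the canonical coordinates are well defined and regular near the origin
    (∀ᶠ u in 𝓝 (0 : B → ℝ),
      IsExp Ω (combination X B u) xbar (canonicalMap Ω X B xbar u) ∧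
      ContDiffAt ℝ ∞ (canonicalMap Ω X B xbar) u ∧
      (fderiv ℝ (canonicalMap Ω X B xbar) u).IsInvertible) ∧
    -- every commutator, written in these coordinates, has weight at least `-|I|`
    ∀ I : MultiIndex n, I ≠ [] →
      FieldHasWeightGE (-(weight I : ℤ))
        (VectorField.pullback ℝ (canonicalMap Ω X B xbar) (iterBracket X I)) := by
  set Φ := canonicalMap Ω X B xbar with hΦdef
  have hXs := contDiffOn_iterBracket hΩ hX
  obtain ⟨hflow, hΦ0, hdΦ0⟩ := eventually_expField_sum hΩ (W := fun I : B => iterBracket X I.1)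
    (fun I => hXs I.1) hxbar (Φ := Φ) fun u => rfl
  obtain ⟨hli, hspan⟩ := hBasis xbar hxbar
  have hsmooth0 : ContDiffAt ℝ ∞ Φ 0 := hflow.self_of_nhds.2.1
  let b := Module.Basis.mk hli hspan.ge
  let A : (B → ℝ) ≃L[ℝ] EuclideanSpace ℝ (Fin p) := b.equivFun.symm.toContinuousLinearEquiv
  -- The derivative at 0 sends the standard basis to the basis X_[I](x̄); invertibility persists
  -- nearby, being an open condition.
  have hA : fderiv ℝ Φ 0 = (A : (B → ℝ) →L[ℝ] EuclideanSpace ℝ (Fin p)) := by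
    refine ContinuousLinearMap.ext fun v => ?_
    rw [hdΦ0]
    simp [A, b, Module.Basis.equivFun_symm_apply]
  have hinv : ∀ᶠ u in 𝓝 (0 : B → ℝ), (fderiv ℝ Φ u).IsInvertible := by
    have h1 : ContinuousAt (fderiv ℝ Φ) 0 :=
      (hsmooth0.fderiv_right (m := ∞) (by simp)).continuousAt
    have h2 := A.nhds
    rw [← hA] at h2
    exact h1.eventually h2
  have hmem : ∀ᶠ u in 𝓝 (0 : B → ℝ), Φ u ∈ Ω :=
    hsmooth0.continuousAt.eventually (hΩ.mem_nhds (hΦ0.symm ▸ hxbar))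
  have hpull : ∀ {V : EuclideanSpace ℝ (Fin p) → EuclideanSpace ℝ (Fin p)},
      ContDiffOn ℝ ∞ V Ω → ∀ᶠ u in 𝓝 (0 : B → ℝ),
        ContDiffAt ℝ ∞ (VectorField.pullback ℝ Φ V) u := by
    intro V hV
    filter_upwards [hflow, hinv, hmem] with u h1 h2 h3
    exact contDiffAt_pullback h1.2.1 h2 (hV.contDiffAt (hΩ.mem_nhds h3))
  have hcoef : ∀ {V : EuclideanSpace ℝ (Fin p) → EuclideanSpace ℝ (Fin p)},
      ContDiffOn ℝ ∞ V Ω → ∀ K : B, SmoothNear fun u => VectorField.pullback ℝ Φ V u K :=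
    fun hV K => (hpull hV).mono fun u hu => contDiffAt_pi.1 hu K
  let Y : B → (B → ℝ) → B → ℝ := fun J => VectorField.pullback ℝ Φ (iterBracket X J.1)
  have hrad : (fun u => ∑ I : B, u I • Y I u) =ᶠ[𝓝 0] fun u => u := by
    filter_upwards [hflow, hinv] with u h1 ⟨M, hM⟩
    have h2 : M u = ∑ I : B, u I • iterBracket X I.1 (Φ u) := by
      rw [← h1.2.2, ← hM]; rfl
    simp only [Y, VectorField.pullback_eq_of_fderiv_eq hM, ← map_smul, ← map_sum, ← h2]
    simp
  have hweight := iterPderiv_eq_zero_of_structureEquation (w := fun I : B => weight I.1) (r := r)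
    (fun K => (hBr K.1 K.2).2) (f := fun J K u => Y J u K)
    (fun J K => hcoef (hXs J.1) K)
    (fun J K => by
      have h1 : A (Pi.single J 1) = iterBracket X J.1 (Φ 0) := by
        change (A : (B → ℝ) →L[ℝ] EuclideanSpace ℝ (Fin p)) (Pi.single J 1) = _
        rw [← hA, hdΦ0, hΦ0, Fintype.sum_eq_single J fun I hI => by simp [hI]]
        simp
      simp only [Y, VectorField.pullback_eq_of_fderiv_eq hA.symm, ← h1]
      simp [Pi.single_apply, eq_comm])
    (h := fun I J K u =>
      VectorField.pullback ℝ Φ (VectorField.lieBracket ℝ (iterBracket X I.1) (iterBracket X J.1)) u K)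
    (fun I J K => hcoef (contDiffOn_lieBracket hΩ (hXs I.1) (hXs J.1)) K)
    (fun J K => by
      filter_upwards [hflow, hmem, hrad.eventually_nhds,
        Filter.eventually_all.2 fun I : B => hpull (hXs I.1)] with u h1 h2 h3 h4
      have hd : ∀ I : B, DifferentiableAt ℝ (Y I) u := fun I => (h4 I).differentiableAt (by simp)
      have hdX : ∀ I : B, DifferentiableAt ℝ (iterBracket X I.1) (Φ u) := fun I =>
        ((hXs I.1).contDiffAt (hΩ.mem_nhds h2)).differentiableAt (by simp)
      have h5 := congrFun (fderiv_radial hd h3 J) K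
      have h6 : fderiv ℝ (fun u => Y J u K) u u = fderiv ℝ (Y J) u u K := by
        rw [((hasFDerivAt_pi'.1 (hd J).hasFDerivAt) K).fderiv]
        rfl
      rw [h6, h5]
      simp only [Pi.add_apply, Pi.sub_apply, Finset.sum_apply, Pi.smul_apply, smul_eq_mul]
      congr 1
      refine Finset.sum_congr rfl fun I _ => ?_
      rw [VectorField.pullback_lieBracket minSmoothness_two_le_infty h1.2.1 (hdX I) (hdX J)])
    (fun I J hIJ => by
      obtain ⟨c, hcw, hc⟩ := eq_sum_coe_of_mem_commutatorSpan hΩ hX (hfree xbar hxbar) hBr hspan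
        hIJ (lieBracket_iterBracket_mem_commutatorSpan hΩ hX (hBr I.1 I.2).1 (hBr J.1 J.2).1)
      refine ⟨c, hcw, fun K => ?_⟩
      filter_upwards [hmem] with u hu
      rw [pullback_eq_sum (hc _ hu)]
      simp [Y])
  refine ⟨?_, fun I hI K => ⟨hcoef (hXs I) K, fun k J hJ => ?_⟩⟩
  · filter_upwards [hflow, hinv] with u h1 h2 using ⟨h1.1, h1.2.1, h2⟩
  -- The total weight in `hJ` is nonnegative, so `hJ` forces |I| < |K| ≤ r. Hence X_[I] expands in
  -- basis fields of its own weight, and for |I| ≥ |K| there is nothing to prove.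
  have hKr := (hBr K.1 K.2).2
  have hpos : 0 ≤ ∑ i, (weight (J i).1 : ℤ) := Finset.sum_nonneg fun i _ => by positivity
  rw [iteratedFDeriv_eq_iterPderiv (hcoef (hXs I) K)]
  obtain ⟨c, hcw, hc⟩ := eq_sum_coe_of_mem_commutatorSpan hΩ hX (hfree xbar hxbar) hBr hspan
    (by omega) (iterBracket_mem_commutatorSpan hI)
  have heq : (fun u => VectorField.pullback ℝ Φ (iterBracket X I) u K) =ᶠ[𝓝 0]
      fun u => ∑ M : B, c M * Y M u K := by
    filter_upwards [hmem] with u hu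
    rw [pullback_eq_sum (hc _ hu)]
    simp [Y]
  rw [iterPderiv_congr _ heq, iterPderiv_sum _ fun M _ => (hcoef (hXs M.1) K).const_mul _]
  refine Finset.sum_eq_zero fun M _ => ?_
  rw [iterPderiv_const_mul _ (hcoef (hXs M.1) K)]
  by_cases hcM : c M = 0
  · rw [hcM, zero_mul]
  · have hM := hcw M hcM
    have hsum : ((List.ofFn J).reverse.map fun I : B => weight I.1).sum = ∑ i, weight (J i).1 := by
      rw [List.map_reverse, List.sum_reverse, List.map_ofFn, List.sum_ofFn]
      rfl
    have hlt : ∑ i, weight (J i).1 + weight M.1 < weight K.1 := by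
      zify
      omega
    rw [hweight _ M K (by rw [hsum]; exact hlt), mul_zero]
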